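/- Let $d\ge 2$, let $\Lambda\subset\mathbb Z^d$ be finite or infinite, and let $G=(G(x,y))_{x,y\in\Lambda}$ be a symmetric positive-definite matrix. Let $\phi=(\phi(x))_{x\in\Lambda}$ be a Gaussian field on $\Lambda$ with covariance $G$, defined on a probability space $(\Omega,\mathbf P)$: if $\Lambda$ is finite, the law of $\phi$ is $$\mu_{\Lambda,G}(dv)=\frac1{Z_{\Lambda,G}}\exp\!\Big(-\tfrac12\langle v,G^{-1}v\rangle\Big)\,dv \quad\text{on } \mathbb R^\Lambda ,$$ and if $\Lambda$ is infinite, every finite set of sites lies in a finite $T\subset\Lambda$ for which $(\phi(x))_{x\in T}$ has the law $\mu_{T,G_T}$, where $G_T=(G(x,y))_{x,y\in T}$. Let $H\subset L^2(\mathbf P)$ be the closed linear span of the $\phi(x)$. Let $\bar{\mathcal P}_n(H)$ be the $L^2$-closure of the polynomials of degree at most $n$ in finitely many elements of $H$, let $H^{:0:}=\mathbb R$ and $H^{:n:}=\bar{\mathcal P}_n(H)\cap\bar{\mathcal P}_{n-1}(H)^\perp$ for $n\ge1$, and let $\pi_n$ be the orthogonal projection of $L^2(\mathbf P)$ onto $H^{:n:}$.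 The Wick power is $:\phi(x)^n:\;=\pi_n(\phi(x)^n)$. Let $f:\mathbb R\to\mathbb R$, $f(t)=\sum_{n\ge 0}a_nt^n$ for all $t\in\mathbb R$, and let $A=\{x_1,\dots,x_k\}\subset\Lambda$ be a set of $k\ge1$ distinct sites. Put $p=\max(2,k)$ and assume that for every $x\in A$ the series $$:f(\phi(x)):\;=\sum_{n\ge0}a_n:\phi(x)^n:$$ converges in $L^{p}(\mathbf P)$. For $n=(n_1,\dots,n_k)\in\mathbb N^k$ let $MG_0(n)$ be the set of undirected multigraphs without self-loops on the vertices $1,\dots,k$ in which vertex $i$ has exactly $n_i$ edges, that is, of symmetric matrices $q=(q_{ij})$ of natural numbers with zero diagonal and $\sum_jq_{ij}=n_i$ for all $i$. Such a $q$ is connected if there is a path between any two vertices (a single vertex is connected). Let $\delta(q)$ be the number of complete Feynman diagrams giving rise to $q$, i.e. the number of perfect matchings of a set of $n_1+\dots+n_k$ labelled half-edges, $n_i$ of them at vertex $i$, in which exactly $q_{ij}$ pairs join a half-edge at $i$ to a half-edge at $j$ for all $i\neq j$, and no pair joins two half-edges at the same vertex. The joint cumulant is $$k(X_1,\dots,X_k)=\sum_{\pi}(|\pi|-1)!\,(-1)^{|\pi|-1}\prod_{B\in\pi}\mathbf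 E\Big[\prod_{i\in B}X_i\Big],$$ the sum being over all partitions $\pi$ of $\{1,\dots,k\}$. Then for all $n\in\mathbb N^k$ and $q\in MG_0(n)$ $$\delta(q)=\frac{\prod_{i=1}^k n_i!}{\prod_{1\le i<j\le k}q_{ij}!},$$ for every $B\subset A$ the product $\prod_{x\in B}:f(\phi(x)):$ is integrable, and $$\mathbf E\Big[\prod_{x\in A}:f(\phi(x)):\Big]=\sum_{n_1,\dots,n_k\ge 0}\Big(\prod_{i=1}^ka_{n_i}\Big)\sum_{q\in MG_0(n)}\delta(q)\prod_{1\le i\le j\le k}G(x_i,x_j)^{q_{ij}},$$ $$k\big(:f(\phi(x)):\ \text{for }x\in A\big)=\sum_{n_1,\dots,n_k\ge 0}\Big(\prod_{i=1}^ka_{n_i}\Big)\sum_{\substack{q\in MG_0(n)\\ q\text{ connected}}}\delta(q)\prod_{1\le i\le j\le k}G(x_i,x_j)^{q_{ij}}.$$ Here the multiple series converge in the sense that the partial sums over $n_1<N_1,\dots,n_k<N_k$ converge as $N_1,\dots,N_k\to\infty$ independently. If moreover $\sum_n|a_n|\,\|:\phi(x)^n:\|_{L^p}<\infty$ for every $x\in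 A$, then both multiple series converge absolutely. -/

import Mathlib

open MeasureTheory Filter Topology
open scoped ENNReal

namespace WickAnalytic

noncomputable section

/-! ### Gaussian fields on a lattice -/

/-- The unnormalised density `exp (-⟨v, G⁻¹ v⟩ / 2)` on `ℝ^ι`. -/
def gaussianWeight {ι : Type*} [Fintype ι] [DecidableEq ι] (G : Matrix ι ι ℝ) (v : ι → ℝ) :
    ℝ≥0∞ :=
  ENNReal.ofReal (Real.exp (-(1 / 2 : ℝ) * (v ⬝ᵥ (G⁻¹).mulVec v)))

/-- The measure `μ_{ι,G}(dv) = Z⁻¹ exp (-⟨v, G⁻¹ v⟩ / 2) dv` on `ℝ^ι`, for a finite index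
set `ι` and a positive definite `G`. -/
def latticeGaussian {ι : Type*} [Fintype ι] [DecidableEq ι] (G : Matrix ι ι ℝ) :
    Measure (ι → ℝ) :=
  (∫⁻ v, gaussianWeight G v)⁻¹ • (volume : Measure (ι → ℝ)).withDensity (gaussianWeight G)

open Classical in
/-- `φ` is a Gaussian field with covariance `G` on `(Ω, P)`: every finite set of sites lies in a
finite set `T` of sites on which `φ` has the law `μ_{T,G}`. If the index set `L` is finite this
says exactly that the law of `φ` is `μ_{L,G}`; if `L` is infinite it says that the
finite-dimensional laws are the centred Gaussian ones with covariance `G`. -/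
def IsGaussianField {L Ω : Type*} [MeasurableSpace Ω] (P : Measure Ω) (G : Matrix L L ℝ)
    (φ : L → Ω → ℝ) : Prop :=
  (∀ x, AEMeasurable (φ x) P) ∧
    ∀ S : Finset L, ∃ T : Finset L, S ⊆ T ∧
      P.map (fun ω (t : T) => φ t ω) =
        latticeGaussian (G.submatrix (fun t : T => (t : L)) (fun t : T => (t : L)))

/-! ### Wick powers -/

section Wick

variable {Ω : Type*} [MeasurableSpace Ω] (P : Measure Ω)

/-- The Gaussian Hilbert space of the field: the closed linear span of the `φ x` in `L²`. -/
def gaussianSpace {L : Type*} (φ : L → Ω → ℝ) : Submodule ℝ (Lp ℝ 2 P) :=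
  (Submodule.span ℝ {F : Lp ℝ 2 P | ∃ x, F =ᵐ[P] φ x}).topologicalClosure

variable {P}

/-- The closure in `L²` of the space of polynomials `p(ξ₁, …, ξₘ)` of degree at most `n` in
finitely many elements of `H`. -/
def polyClosure (H : Submodule ℝ (Lp ℝ 2 P)) (n : ℕ) : Submodule ℝ (Lp ℝ 2 P) :=
  (Submodule.span ℝ {F : Lp ℝ 2 P | ∃ (m : ℕ) (ξ : Fin m → H) (p : MvPolynomial (Fin m) ℝ),
    p.totalDegree ≤ n ∧
      F =ᵐ[P] fun ω => MvPolynomial.eval (fun i => (ξ i : Lp ℝ 2 P) ω) p}).topologicalClosure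

/-- The homogeneous chaos `H^{:n:}`: the constants for `n = 0`, and for `n ≥ 1` the elements of
the closed space of polynomials of degree at most `n` that are orthogonal to those of degree
at most `n - 1`. -/
def chaos (H : Submodule ℝ (Lp ℝ 2 P)) : ℕ → Submodule ℝ (Lp ℝ 2 P)
  | 0 => polyClosure H 0
  | n + 1 => polyClosure H (n + 1) ⊓ (polyClosure H n)ᗮ

theorem isClosed_chaos (H : Submodule ℝ (Lp ℝ 2 P)) (n : ℕ) :
    IsClosed (chaos H n : Set (Lp ℝ 2 P)) := by
  cases n with
  | zero => exact Submodule.isClosed_topologicalClosure _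
  | succ n =>
    exact (Submodule.isClosed_topologicalClosure _).inter (Submodule.isClosed_orthogonal _)

instance (H : Submodule ℝ (Lp ℝ 2 P)) (n : ℕ) : CompleteSpace (chaos H n) :=
  (isClosed_chaos H n).completeSpace_coe

variable (P) in
open Classical in
/-- The Wick power `:φ(x)ⁿ: = π_n (φ(x)ⁿ)`, where `π_n` is the orthogonal projection of `L²` onto
the chaos `H^{:n:}` of the Gaussian Hilbert space `H` of the field. (The powers of a Gaussian
variable are in `L²`; the second branch never occurs for a Gaussian field.) -/
def wickPower {L : Type*} (φ : L → Ω → ℝ) (x : L) (n : ℕ) : Lp ℝ 2 P :=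
  if h : MemLp (fun ω => φ x ω ^ n) 2 P then
    (chaos (gaussianSpace P φ) n).starProjection (h.toLp _)
  else 0

variable (P) in
/-- `X` is `:f(φ(x)): = ∑ aₙ :φ(x)ⁿ:` for `f(t) = ∑ aₙ tⁿ`, the series converging in `L^p`. -/
def IsWickSeries {L : Type*} (p : ℝ≥0∞) (φ : L → Ω → ℝ) (x : L) (a : ℕ → ℝ) (X : Ω → ℝ) :
    Prop :=
  MemLp X p P ∧
    Tendsto (fun N : ℕ => eLpNorm
      (fun ω => X ω - ∑ n ∈ Finset.range N, a n * wickPower P φ x n ω) p P) atTop (𝓝 0)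

variable (P) in
/-- The joint cumulant of `X₁, …, X_k`: the sum over the partitions `π` of the index set of
`(|π| - 1)! (-1)^(|π| - 1) ∏_{B ∈ π} E[∏_{i ∈ B} X_i]`. -/
def jointCumulant {k : ℕ} (X : Fin k → Ω → ℝ) : ℝ :=
  ∑ π : Finpartition (Finset.univ : Finset (Fin k)),
    ((π.parts.card - 1).factorial : ℝ) * (-1) ^ (π.parts.card - 1) *
      ∏ B ∈ π.parts, ∫ ω, ∏ i ∈ B, X i ω ∂P

end Wick

/-! ### Multigraphs and Feynman diagrams -/

/-- The undirected multigraphs on `k` vertices without self-loops in which vertex `i` has exactly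
`n i` edges: `q i j` is the number of edges between `i` and `j`. (Entries are bounded by the
degrees, so restricting their range to make the set finite loses nothing, see
`mem_multigraphs`.) -/
def multigraphs {k : ℕ} (n : Fin k → ℕ) : Finset (Fin k → Fin k → ℕ) :=
  (Fintype.piFinset fun i => Fintype.piFinset fun _ => Finset.range (n i + 1)).filter fun q =>
    (∀ i j, q i j = q j i) ∧ (∀ i, q i i = 0) ∧ ∀ i, ∑ j, q i j = n i

theorem mem_multigraphs {k : ℕ} {n : Fin k → ℕ} {q : Fin k → Fin k → ℕ} :
    q ∈ multigraphs n ↔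
      (∀ i j, q i j = q j i) ∧ (∀ i, q i i = 0) ∧ ∀ i, ∑ j, q i j = n i := by
  simp only [multigraphs, Finset.mem_filter, Fintype.mem_piFinset, Finset.mem_range,
    Nat.lt_succ_iff, and_iff_right_iff_imp]
  rintro ⟨-, -, h⟩ i j
  rw [← h i]
  exact Finset.single_le_sum (f := q i) (fun _ _ => Nat.zero_le _) (Finset.mem_univ j)

/-- A multigraph is connected if there is a path between any two vertices. -/
def MultigraphConnected {k : ℕ} (q : Fin k → Fin k → ℕ) : Prop :=
  (SimpleGraph.fromRel fun i j => q i j ≠ 0).Preconnected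

open Classical in
/-- The connected ones among `multigraphs n`. -/
def connectedMultigraphs {k : ℕ} (n : Fin k → ℕ) : Finset (Fin k → Fin k → ℕ) :=
  (multigraphs n).filter MultigraphConnected

/-- The multiplicity `δ(q)`: the number of complete Feynman diagrams (perfect matchings) on the
set of `n 1 + ⋯ + n k` labelled half-edges, `n i` of them at vertex `i`, that give the multigraph
`q` when the half-edges at each vertex are merged. A perfect matching is given as the involution
`γ` without fixed points that exchanges the two ends of each edge; it gives `q` if exactly `q i j`
of the half-edges at `i` have their partner at `j`. -/
def feynmanCount {k : ℕ} (n : Fin k → ℕ) (q : Fin k → Fin k → ℕ) : ℕ :=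
  Fintype.card {γ : Equiv.Perm (Σ i : Fin k, Fin (n i)) //
    (∀ v, γ (γ v) = v) ∧ (∀ v, γ v ≠ v) ∧
      ∀ i j, (Finset.univ.filter fun s : Fin (n i) => (γ ⟨i, s⟩).1 = j).card = q i j}

/-- `∏_{i ≤ j} g(i,j)^{q i j}`. -/
def edgeProd {k : ℕ} (g : Fin k → Fin k → ℝ) (q : Fin k → Fin k → ℕ) : ℝ :=
  ∏ i, ∏ j ∈ Finset.Ici i, g i j ^ q i j

/-! ### Multiple series -/

/-- The multiple series `∑_{n₁, …, n_k} T(n₁, …, n_k)` converges to `s`: its rectangular partial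
sums `∑_{n₁ < N₁, …, n_k < N_k} T(n₁, …, n_k)` tend to `s` as `N₁, …, N_k → ∞` independently. -/
def HasMultiSum {k : ℕ} (T : (Fin k → ℕ) → ℝ) (s : ℝ) : Prop :=
  Tendsto (fun N : Fin k → ℕ => ∑ n ∈ Fintype.piFinset fun i => Finset.range (N i), T n)
    atTop (𝓝 s)

end

end WickAnalytic

open WickAnalytic

namespace WickAnalytic

open ProbabilityTheory
open scoped NNReal

noncomputable section

/-! Finite combinations of the field are centred Gaussian, and an L² limit of such variables is
again one, so any finite family in `gaussianSpace` is jointly Gaussian. Regressing on one member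
gives integration by parts, E[X_i p] = ∑_j C_ij E[∂_j p], for all polynomials p. Together with E[1]
= 1 and the symmetry of C, this identity (`IsSteinFunctional`) yields everything of finite degree.

For the Hermite polynomials h_n of variance C_ii, the subtracted term of the three-term recursion
cancels the derivative that falls on h_n itself. What remains is E[h_{n+1}(X_i) p] = ∑_j C_ij
E[h_n(X_i) ∂_j p] (`IsSteinFunctional.hermiteX_mul`). Hence h_{n+1} is orthogonal to all polynomials
of degree at most n, and since it is monic it is the Wick power. The same identity contracts one
half-edge at i with one at j ≠ i. The weights ∏ C_ij^{q_ij} / q_ij! obey the same recursion when an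
edge is removed, so E ∏ h_{n_l} is ∏ n_l! times a sum over multigraphs
(`IsSteinFunctional.prod_hermiteX`). A direct count of diagrams shows that ∏ n_l! / ∏ q_ij! is δ(q).

Splitting a multigraph into the component of a chosen vertex and the rest gives the recursion that
determines cumulants from moments, so cumulants are sums over connected multigraphs
(`setCumulant_graphSum`).

Expectations of products and joint cumulants are multilinear, so the rectangular partial sums are
exactly the moment and the cumulant of the truncated Wick series. Hölder's inequality with at most k
factors in L^p, p ≥ k, passes to the limit, and it also bounds the terms when the Wick series
converge absolutely. -/

/-! ### The lattice Gaussian measure as a multivariate Gaussian -/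

theorem lintegral_pi_prod_ofReal {ι : Type*} [Fintype ι] {f : ι → ℝ → ℝ}
    (hf : ∀ i, Integrable (f i)) (hf0 : ∀ i x, 0 ≤ f i x) :
    ∫⁻ w : ι → ℝ, ∏ i, ENNReal.ofReal (f i (w i)) = ∏ i, ∫⁻ x, ENNReal.ofReal (f i x) := by
  simp_rw [← ENNReal.ofReal_prod_of_nonneg (fun i _ => hf0 i _)]
  rw [volume_pi, ← ofReal_integral_eq_lintegral_ofReal (f := fun w : ι → ℝ => ∏ i, f i (w i))
    (Integrable.fintype_prod hf)
    (ae_of_all _ fun w => Finset.prod_nonneg fun i _ => hf0 i _),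
    integral_fintype_prod_eq_prod,
    ENNReal.ofReal_prod_of_nonneg (fun i _ => integral_nonneg (hf0 i))]
  exact Finset.prod_congr rfl fun i _ =>
    ofReal_integral_eq_lintegral_ofReal (hf i) (ae_of_all _ (hf0 i))

/-- Boxes determine a product measure, and the indicator of a box can be absorbed into the
one-dimensional densities, after which the integral factorises. -/
theorem pi_gaussianReal_eq_withDensity {ι : Type*} [Fintype ι] :
    Measure.pi (fun _ : ι => gaussianReal 0 1) =
      (volume : Measure (ι → ℝ)).withDensity fun w => ∏ i, gaussianPDF 0 1 (w i) := by
  refine Measure.pi_eq fun s hs => ?_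
  have hmeas := MeasurableSet.univ_pi hs
  rw [withDensity_apply _ hmeas, ← lintegral_indicator hmeas]
  have key := lintegral_pi_prod_ofReal (ι := ι) (f := fun i => (s i).indicator (gaussianPDFReal 0 1))
    (fun i => (integrable_gaussianPDFReal 0 1).indicator (hs i))
    (fun i x => Set.indicator_nonneg (fun y _ => gaussianPDFReal_nonneg 0 1 y) x)
  have h1 : ∀ i, gaussianReal 0 1 (s i) =
      ∫⁻ x, ENNReal.ofReal ((s i).indicator (gaussianPDFReal 0 1) x) := by
    intro i
    rw [gaussianReal_apply 0 one_ne_zero, ← lintegral_indicator (hs i)]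
    refine lintegral_congr fun x => ?_
    by_cases hx : x ∈ s i <;> simp [hx, gaussianPDF]
  simp_rw [h1, ← key]
  refine lintegral_congr fun w => ?_
  by_cases hw : w ∈ Set.univ.pi s
  · rw [Set.indicator_of_mem hw]
    refine Finset.prod_congr rfl fun i _ => ?_
    rw [Set.indicator_of_mem (hw i (Set.mem_univ i)), gaussianPDF]
  · rw [Set.indicator_of_notMem hw]
    simp only [Set.mem_pi, Set.mem_univ, true_imp_iff, not_forall] at hw
    obtain ⟨i, hi⟩ := hw
    exact (Finset.prod_eq_zero (Finset.mem_univ i) (by simp [hi])).symm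

theorem prod_gaussianPDF_eq {ι : Type*} [Fintype ι] (w : ι → ℝ) :
    ∏ i, gaussianPDF 0 1 (w i) =
      ENNReal.ofReal (∏ _i : ι, (√(2 * Real.pi))⁻¹) *
        ENNReal.ofReal (Real.exp (-(1 / 2 : ℝ) * (w ⬝ᵥ w))) := by
  simp only [gaussianPDF]
  rw [← ENNReal.ofReal_prod_of_nonneg (fun i _ => gaussianPDFReal_nonneg _ _ _),
    ← ENNReal.ofReal_mul (by positivity)]
  congr 1
  simp only [gaussianPDFReal, Finset.prod_mul_distrib, ← Real.exp_sum]
  congr 1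
  · simp
  · simp only [dotProduct, Finset.mul_sum]
    congr 1
    refine Finset.sum_congr rfl fun i _ => ?_
    simp; ring

open Matrix in
theorem map_withDensity_linearEquiv {ι : Type*} [Fintype ι] [DecidableEq ι] {A : Matrix ι ι ℝ}
    (hA : A.det ≠ 0) {g : (ι → ℝ) → ℝ≥0∞} (hg : Measurable g) :
    ((volume : Measure (ι → ℝ)).withDensity g).map (Matrix.toLin' A) =
      ENNReal.ofReal |A.det⁻¹| •
        (volume : Measure (ι → ℝ)).withDensity fun v => g (A⁻¹.mulVec v) := by
  have hmA : Measurable (Matrix.toLin' A) :=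
    (LinearMap.continuous_of_finiteDimensional _).measurable
  have hmA' : Measurable fun v => A⁻¹.mulVec v :=
    (LinearMap.continuous_of_finiteDimensional (Matrix.toLin' A⁻¹)).measurable
  ext s hs
  rw [Measure.map_apply hmA hs, withDensity_apply _ (hmA hs), Measure.smul_apply,
    withDensity_apply _ hs, ← lintegral_smul_measure, ← Measure.restrict_smul,
    ← Real.map_matrix_volume_pi_eq_smul_volume_pi hA,
    setLIntegral_map (f := fun v => g (A⁻¹.mulVec v)) hs (hg.comp hmA') hmA]
  refine lintegral_congr fun w => ?_
  simp [Matrix.toLin'_apply, Matrix.mulVec_mulVec, Matrix.nonsing_inv_mul _ (Ne.isUnit hA)]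

-- With A = √G, the image of independent standard Gaussians under A has a density proportional to
-- exp(-|A⁻¹v|²/2), and |A⁻¹v|² = ⟨v, G⁻¹v⟩ because A is symmetric with A² = G.
open Matrix in
open scoped MatrixOrder Matrix.Norms.L2Operator in
theorem latticeGaussian_eq_map {ι : Type*} [Fintype ι] [DecidableEq ι] {G : Matrix ι ι ℝ}
    (hG : G.PosDef) :
    latticeGaussian G = (multivariateGaussian 0 G).map WithLp.ofLp := by
  set A := CFC.sqrt G with hAdef
  have hAA : A * A = G := CFC.sqrt_mul_sqrt_self _ hG.posSemidef.nonneg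
  have hAt : Aᵀ = A := by
    have : IsSelfAdjoint A := (CFC.sqrt_nonneg G).isSelfAdjoint
    simpa [IsSelfAdjoint, star_eq_conjTranspose] using this
  have hdet : A.det ≠ 0 := by
    intro h
    have := hG.det_pos
    rw [← hAA, det_mul, h] at this
    simp at this
  have hquad : ∀ v : ι → ℝ, (A⁻¹ *ᵥ v) ⬝ᵥ (A⁻¹ *ᵥ v) = v ⬝ᵥ (G⁻¹ *ᵥ v) := by
    intro v
    rw [← hAA, Matrix.mul_inv_rev, ← Matrix.mulVec_mulVec, Matrix.dotProduct_mulVec v,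
      ← Matrix.mulVec_transpose, Matrix.transpose_nonsing_inv, hAt]
  have h1 : (multivariateGaussian 0 G).map WithLp.ofLp =
      (Measure.pi (fun _ : ι => gaussianReal 0 1)).map (Matrix.toLin' A) := by
    rw [multivariateGaussian, ← map_pi_eq_stdGaussian, Measure.map_map (by fun_prop) (by fun_prop),
      Measure.map_map (by fun_prop) (by fun_prop)]
    congr 1
    ext w i
    simp [Matrix.toLin'_apply, A]
  have hprob : IsProbabilityMeasure ((multivariateGaussian 0 G).map WithLp.ofLp) :=
    Measure.isProbabilityMeasure_map (by fun_prop)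
  have hmeas : Measurable fun w : ι → ℝ => ENNReal.ofReal (Real.exp (-(1 / 2 : ℝ) * (w ⬝ᵥ w))) := by
    unfold dotProduct
    fun_prop
  obtain ⟨c, hc⟩ : ∃ c : ℝ≥0∞, (multivariateGaussian 0 G).map WithLp.ofLp =
      c • (volume : Measure (ι → ℝ)).withDensity (gaussianWeight G) := by
    refine ⟨ENNReal.ofReal (∏ _i : ι, (√(2 * Real.pi))⁻¹) * ENNReal.ofReal |A.det⁻¹|, ?_⟩
    rw [h1, pi_gaussianReal_eq_withDensity]
    simp_rw [prod_gaussianPDF_eq]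
    have := withDensity_smul (μ := (volume : Measure (ι → ℝ)))
      (ENNReal.ofReal (∏ _i : ι, (√(2 * Real.pi))⁻¹)) hmeas
    simp only [Pi.smul_def, smul_eq_mul] at this
    rw [this, Measure.map_smul, map_withDensity_linearEquiv hdet hmeas, smul_smul]
    simp_rw [hquad]
    rfl
  -- Total mass 1 identifies the constant `c` with the inverse of the normalising integral, which
  -- therefore need not be evaluated.
  have hu := hprob.measure_univ
  rw [hc, Measure.smul_apply, withDensity_apply _ MeasurableSet.univ, Measure.restrict_univ,
    smul_eq_mul] at hu
  rw [hc, latticeGaussian, ENNReal.eq_inv_of_mul_eq_one_left hu]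

/-- The joint law of finitely many coordinates of a Gaussian field. -/
theorem IsGaussianField.exists_law {L Ω : Type*} [MeasurableSpace Ω] {P : Measure Ω}
    {G : Matrix L L ℝ} (hG : G.PosDef) {φ : L → Ω → ℝ} (hφ : IsGaussianField P G φ)
    (S : Finset L) : ∃ T : Finset L, S ⊆ T ∧ HasGaussianLaw (fun ω (t : T) => φ t ω) P ∧
      (∀ t ∈ T, ∫ ω, φ t ω ∂P = 0) ∧ ∀ s ∈ T, ∀ t ∈ T, cov[φ s, φ t; P] = G s t := by
  classical
  obtain ⟨hm, h⟩ := hφ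
  obtain ⟨T, hST, hT⟩ := h S
  refine ⟨T, hST, ?_⟩
  have hGT : (G.submatrix (fun t : T => (t : L)) (fun t : T => (t : L))).PosDef :=
    hG.submatrix Subtype.val_injective
  have hlaw : P.map (fun ω (t : T) => φ t ω) = (multivariateGaussian 0
      (G.submatrix (fun t : T => (t : L)) (fun t : T => (t : L)))).map WithLp.ofLp := by
    rw [← latticeGaussian_eq_map hGT, hT]
  have hmT : AEMeasurable (fun ω (t : T) => φ t ω) P := aemeasurable_pi_lambda _ fun t => hm t
  refine ⟨⟨?_⟩, ?_, ?_⟩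
  · rw [hlaw]
    exact isGaussian_map (PiLp.continuousLinearEquiv 2 ℝ (fun _ : T => ℝ)).toContinuousLinearMap
  · intro t ht
    have : ∫ ω, φ t ω ∂P = ∫ v, v ⟨t, ht⟩ ∂(P.map (fun ω (t : T) => φ t ω)) := by
      rw [integral_map hmT (measurable_pi_apply (⟨t, ht⟩ : T)).aestronglyMeasurable]
    rw [this, hlaw, integral_map (f := fun v : T → ℝ => v ⟨t, ht⟩) (by fun_prop)
      (measurable_pi_apply (⟨t, ht⟩ : T)).aestronglyMeasurable]
    have h2 := ContinuousLinearMap.integral_comp_comm (EuclideanSpace.proj (𝕜 := ℝ) (⟨t, ht⟩ : T))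
      (φ := id) (μ := multivariateGaussian 0
      (G.submatrix (fun t : T => (t : L)) (fun t : T => (t : L)))) IsGaussian.integrable_id
    simpa using h2
  · intro s hs t ht
    have hc := covariance_eval_multivariateGaussian (μ := 0) hGT.posSemidef ⟨s, hs⟩ ⟨t, ht⟩
    simp only [Matrix.submatrix_apply] at hc
    rw [← hc]
    have h1 := covariance_map (μ := P) (Z := fun ω (t : T) => φ t ω)
      (X := fun v : T → ℝ => v ⟨s, hs⟩) (Y := fun v : T → ℝ => v ⟨t, ht⟩)
      (measurable_pi_apply (⟨s, hs⟩ : T)).aestronglyMeasurable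
      (measurable_pi_apply (⟨t, ht⟩ : T)).aestronglyMeasurable hmT
    have h2 := covariance_map (μ := multivariateGaussian 0
      (G.submatrix (fun t : T => (t : L)) (fun t : T => (t : L)))) (Z := WithLp.ofLp)
      (X := fun v : T → ℝ => v ⟨s, hs⟩) (Y := fun v : T → ℝ => v ⟨t, ht⟩)
      (measurable_pi_apply (⟨s, hs⟩ : T)).aestronglyMeasurable
      (measurable_pi_apply (⟨t, ht⟩ : T)).aestronglyMeasurable (by fun_prop)
    rw [hlaw, h2] at h1
    exact h1.symm

/-! ### Variables with moments of all orders -/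

section MemLpAll

variable {Ω : Type*} [MeasurableSpace Ω] {P : Measure Ω}

/-- `f` has finite absolute moments of all orders. -/
def HasAllMoments (P : Measure Ω) (f : Ω → ℝ) : Prop := ∀ p : ℝ≥0∞, p ≠ ∞ → MemLp f p P

theorem HasAllMoments.add {f g : Ω → ℝ} (hf : HasAllMoments P f) (hg : HasAllMoments P g) :
    HasAllMoments P fun ω => f ω + g ω :=
  fun p hp => (hf p hp).add (hg p hp)

/-- Hölder with exponents 2p, 2p, p. The loss in the exponent is why all finite exponents are
required at once. -/
theorem HasAllMoments.mul {f g : Ω → ℝ} (hf : HasAllMoments P f) (hg : HasAllMoments P g) :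
    HasAllMoments P fun ω => f ω * g ω := by
  intro p hp
  have h2 : 2 * p ≠ ∞ := ENNReal.mul_ne_top (by simp) hp
  have : ENNReal.HolderTriple (2 * p) (2 * p) p := ⟨by
    rw [ENNReal.mul_inv (by simp) (by simp), ← add_mul, ENNReal.inv_two_add_inv_two, one_mul]⟩
  exact MemLp.mul (hg _ h2) (hf _ h2)

theorem hasAllMoments_const [IsFiniteMeasure P] (c : ℝ) : HasAllMoments P fun _ => c :=
  fun _ _ => memLp_const c

theorem HasAllMoments.congr {f g : Ω → ℝ} (hf : HasAllMoments P f) (h : f =ᵐ[P] g) :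
    HasAllMoments P g := fun p hp => (memLp_congr_ae h).1 (hf p hp)

theorem HasAllMoments.integrable {f : Ω → ℝ} (hf : HasAllMoments P f) : Integrable f P :=
  memLp_one_iff_integrable.1 (hf 1 (by simp))

theorem HasAllMoments.mvPolynomial_eval [IsFiniteMeasure P] {ι : Type*} {f : ι → Ω → ℝ}
    (hf : ∀ i, HasAllMoments P (f i)) (p : MvPolynomial ι ℝ) :
    HasAllMoments P fun ω => MvPolynomial.eval (fun i => f i ω) p := by
  induction p using MvPolynomial.induction_on with
  | C a => simpa using hasAllMoments_const a
  | add p q hp hq => simpa using hp.add hq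
  | mul_X p i hp => simpa using hp.mul (hf i)

theorem HasAllMoments.polynomial_eval [IsFiniteMeasure P] {f : Ω → ℝ}
    (hf : HasAllMoments P f) (p : Polynomial ℝ) :
    HasAllMoments P fun ω => p.eval (f ω) := by
  induction p using Polynomial.induction_on with
  | C a => simpa using hasAllMoments_const a
  | add p q hp hq => simpa using hp.add hq
  | monomial n a h => simpa [pow_succ, ← mul_assoc] using h.mul hf

end MemLpAll

/-! ### Gaussian integration by parts on the line -/

section SteinReal

theorem hasAllMoments_id_gaussianReal (m : ℝ) (v : ℝ≥0) :
    HasAllMoments (gaussianReal m v) fun x => x := fun p hp => memLp_id_gaussianReal' p hp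

/-- The degenerate case `v = 0` is included: the density is then identically zero. -/
theorem hasDerivAt_gaussianPDFReal {v : ℝ≥0} (x : ℝ) :
    HasDerivAt (gaussianPDFReal 0 v) (-(x / v) * gaussianPDFReal 0 v x) x := by
  have h1 : HasDerivAt (fun y : ℝ => -(y - 0) ^ 2 / (2 * v)) (-(2 * x) / (2 * v)) x := by
    have := (((hasDerivAt_id x).pow 2).neg).div_const (2 * (v : ℝ))
    simpa using this
  have h2 := (h1.exp).const_mul ((√(2 * Real.pi * v))⁻¹)
  refine h2.congr_deriv ?_
  have h3 : -(2 * x) / (2 * (v : ℝ)) = -(x / v) := by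
    rw [neg_div, mul_div_mul_left _ _ two_ne_zero]
  rw [gaussianPDFReal, h3]
  ring

theorem integrable_mul_gaussianPDFReal {v : ℝ≥0} (hv : v ≠ 0) {f : ℝ → ℝ}
    (hf : Integrable f (gaussianReal 0 v)) :
    Integrable fun x => gaussianPDFReal 0 v x * f x := by
  rw [gaussianReal_of_var_ne_zero _ hv, integrable_withDensity_iff_integrable_smul'
    (measurable_gaussianPDF _ _) (ae_of_all _ fun _ => gaussianPDF_lt_top)] at hf
  simpa using hf

/-- Gaussian integration by parts in one dimension, for polynomials. -/
theorem integral_mul_eval_gaussianReal (v : ℝ≥0) (q : Polynomial ℝ) :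
    ∫ x, x * q.eval x ∂gaussianReal 0 v = v * ∫ x, q.derivative.eval x ∂gaussianReal 0 v := by
  by_cases hv : v = 0
  · simp [hv, gaussianReal_zero_var]
  have hid := hasAllMoments_id_gaussianReal 0 v
  have hq := integrable_mul_gaussianPDFReal hv (hid.polynomial_eval q).integrable
  have hq' := integrable_mul_gaussianPDFReal hv (hid.polynomial_eval q.derivative).integrable
  have hxq := integrable_mul_gaussianPDFReal hv (hid.mul (hid.polynomial_eval q)).integrable
  have hv' : (v : ℝ) ≠ 0 := by simpa using hv
  -- The derivative of density times q is density times (q' - xq/v), and the integral of an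
  -- integrable derivative of an integrable function vanishes.
  have key := integral_eq_zero_of_hasDerivAt_of_integrable
    (f := fun x => gaussianPDFReal 0 v x * q.eval x)
    (f' := fun x => gaussianPDFReal 0 v x * q.derivative.eval x -
      (v : ℝ)⁻¹ * (gaussianPDFReal 0 v x * (x * q.eval x)))
    (fun x => by
      refine ((hasDerivAt_gaussianPDFReal x).mul (q.hasDerivAt x)).congr_deriv ?_
      field_simp; ring)
    (hq'.sub (hxq.const_mul _)) hq
  rw [integral_sub hq' (hxq.const_mul _), integral_const_mul, sub_eq_zero] at key
  rw [integral_gaussianReal_eq_integral_smul hv, integral_gaussianReal_eq_integral_smul hv]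
  simp only [smul_eq_mul]
  rw [key]
  field_simp

/-- The chain rule along a polynomial curve; affine `f` reduces integration by parts along a line to
one variable. -/
theorem derivative_aeval_mvPolynomial {ι : Type*} [Fintype ι] (f : ι → Polynomial ℝ)
    (p : MvPolynomial ι ℝ) :
    Polynomial.derivative (MvPolynomial.aeval f p) =
      ∑ j, MvPolynomial.aeval f (MvPolynomial.pderiv j p) * Polynomial.derivative (f j) := by
  classical
  induction p using MvPolynomial.induction_on with
  | C a => simp
  | add p q hp hq => simp [hp, hq, add_mul, Finset.sum_add_distrib]
  | mul_X p i hp =>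
    simp only [map_mul, MvPolynomial.aeval_X, Polynomial.derivative_mul, hp, Derivation.leibniz,
      MvPolynomial.pderiv_X, smul_eq_mul, map_add, add_mul, Finset.sum_add_distrib]
    rw [add_comm]
    congr 1
    · rw [Finset.sum_eq_single i]
      · simp
      · intro b _ hb
        simp [hb.symm]
      · simp
    · rw [Finset.sum_mul]
      exact Finset.sum_congr rfl fun j _ => by ring

/-- Gaussian integration by parts along a line. -/
theorem integral_mul_mvPolynomial_eval_gaussianReal {ι : Type*} [Fintype ι] (v : ℝ≥0)
    (c z : ι → ℝ) (p : MvPolynomial ι ℝ) :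
    ∫ x, x * MvPolynomial.eval (fun j => c j * x + z j) p ∂gaussianReal 0 v =
      v * ∫ x, ∑ j, c j * MvPolynomial.eval (fun j => c j * x + z j) (MvPolynomial.pderiv j p)
        ∂gaussianReal 0 v := by
  set f : ι → Polynomial ℝ := fun j => Polynomial.C (c j) * Polynomial.X + Polynomial.C (z j)
  have hev : ∀ (x : ℝ) (r : MvPolynomial ι ℝ), (MvPolynomial.aeval f r).eval x =
      MvPolynomial.eval (fun j => c j * x + z j) r := by
    intro x r
    rw [← Polynomial.coe_evalRingHom, MvPolynomial.map_aeval, MvPolynomial.eval]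
    congr 1
    congr 1
    · ext; simp
    · ext; simp [f]
  have := integral_mul_eval_gaussianReal v (MvPolynomial.aeval f p)
  simp only [hev] at this
  rw [this]
  congr 1
  refine integral_congr_ae (ae_of_all _ fun x => ?_)
  simp only [derivative_aeval_mvPolynomial, Polynomial.eval_finsetSum, Polynomial.eval_mul, hev]
  exact Finset.sum_congr rfl fun j _ => by simp [f]; ring

end SteinReal

/-! ### Gaussian subspaces of L² and integration by parts -/

section GaussianSpace

variable {Ω : Type*} [MeasurableSpace Ω] {P : Measure Ω}

theorem coeFn_sum_smul {ι : Type*} (s : Finset ι) (c : ι → ℝ) (f : ι → Lp ℝ 2 P) :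
    ⇑(∑ i ∈ s, c i • f i) =ᵐ[P] fun ω => ∑ i ∈ s, c i * f i ω := by
  classical
  induction s using Finset.induction_on with
  | empty => simpa using! Lp.coeFn_zero ℝ 2 P
  | insert a s ha ih =>
    rw [Finset.sum_insert ha]
    filter_upwards [Lp.coeFn_add (c a • f a) (∑ i ∈ s, c i • f i), Lp.coeFn_smul (c a) (f a), ih]
      with ω h1 h2 h3
    rw [h1, Finset.sum_insert ha, Pi.add_apply, h2, h3]
    simp

theorem real_inner_eq_integral (f g : Lp ℝ 2 P) : inner ℝ f g = ∫ ω, f ω * g ω ∂P := by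
  rw [L2.inner_def]
  exact integral_congr_ae (ae_of_all _ fun ω => by simp [mul_comm])

theorem norm_sq_eq_integral (f : Lp ℝ 2 P) : ‖f‖ ^ 2 = ∫ ω, f ω ^ 2 ∂P := by
  rw [← real_inner_self_eq_norm_sq, real_inner_eq_integral]
  simp_rw [sq]

/-- All elements of `H` are centred Gaussian variables. -/
def IsGaussianSubmodule (H : Submodule ℝ (Lp ℝ 2 P)) : Prop :=
  ∀ ξ ∈ H, P.map ξ = gaussianReal 0 (‖ξ‖₊ ^ 2)

theorem aemeasurable_Lp (ξ : Lp ℝ 2 P) : AEMeasurable ξ P :=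
  (Lp.aestronglyMeasurable ξ).aemeasurable

theorem map_eq_gaussianReal_of_hasGaussianLaw {ξ : Lp ℝ 2 P} (h : HasGaussianLaw ξ P)
    (h0 : ∫ ω, ξ ω ∂P = 0) : P.map ξ = gaussianReal 0 (‖ξ‖₊ ^ 2) := by
  rw [h.map_eq_gaussianReal, h0, variance_of_integral_eq_zero (aemeasurable_Lp ξ) h0,
    ← norm_sq_eq_integral]
  congr 1
  ext
  simp

variable {H : Submodule ℝ (Lp ℝ 2 P)}

/-- Cramér–Wold: every linear functional of the vector is again an element of `H`, hence Gaussian.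
-/
theorem IsGaussianSubmodule.hasGaussianLaw (hH : IsGaussianSubmodule H) {ι : Type*} [Fintype ι]
    {η : ι → Lp ℝ 2 P} (hη : ∀ i, η i ∈ H) : HasGaussianLaw (fun ω i => η i ω) P := by
  classical
  refine ⟨isGaussian_of_map_eq_gaussianReal fun L => ?_⟩
  have hmem : ∑ i, L (Pi.single i 1) • η i ∈ H :=
    H.sum_mem fun i _ => H.smul_mem _ (hη i)
  refine ⟨_, _, Eq.trans ?_ (hH _ hmem)⟩
  rw [AEMeasurable.map_map_of_aemeasurable (by fun_prop)
    (aemeasurable_pi_lambda _ fun i => aemeasurable_Lp (η i))]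
  refine Measure.map_congr ?_
  filter_upwards [coeFn_sum_smul Finset.univ (fun i => L (Pi.single i 1)) η] with ω hω
  rw [hω]
  conv_lhs => rw [Function.comp_apply, ← Finset.univ_sum_single (fun i => η i ω), map_sum]
  refine Finset.sum_congr rfl fun i _ => ?_
  have : (Pi.single i (η i ω) : ι → ℝ) = η i ω • Pi.single i 1 := by
    rw [← Pi.single_smul]; simp
  rw [this, map_smul, smul_eq_mul, mul_comm]

theorem IsGaussianSubmodule.hasAllMoments (hH : IsGaussianSubmodule H) {ξ : Lp ℝ 2 P}
    (hξ : ξ ∈ H) : HasAllMoments P ξ := by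
  intro p hp
  have h := memLp_id_gaussianReal' (μ := 0) (v := ‖ξ‖₊ ^ 2) p hp
  rw [← hH ξ hξ, memLp_map_measure_iff (by fun_prop) (aemeasurable_Lp ξ)] at h
  exact h

theorem IsGaussianSubmodule.integral_eq_zero (hH : IsGaussianSubmodule H) {ξ : Lp ℝ 2 P}
    (hξ : ξ ∈ H) : ∫ ω, ξ ω ∂P = 0 := by
  have : ∫ ω, ξ ω ∂P = ∫ x, x ∂(P.map ξ) := by
    rw [integral_map (aemeasurable_Lp ξ) (by fun_prop)]
  rw [this, hH ξ hξ, integral_id_gaussianReal]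

variable [IsProbabilityMeasure P]

/-- From |e^{itξ} - e^{itη}| ≤ |t| |ξ - η| and the domination of the L¹ norm by the L² norm on a
probability space, the map is Lipschitz with constant |t|. -/
theorem continuous_charFun_map (t : ℝ) :
    Continuous fun ξ : Lp ℝ 2 P => charFun (P.map ξ) t := by
  refine (LipschitzWith.of_dist_le_mul (K := ‖t‖₊) fun ξ η => ?_).continuous
  have hrep : ∀ ξ : Lp ℝ 2 P, charFun (P.map ξ) t = ∫ ω, Complex.exp (t * ξ ω * Complex.I) ∂P := by
    intro ξ
    rw [charFun_apply_real, integral_map (aemeasurable_Lp ξ) (by fun_prop)]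
  have hint : ∀ ξ : Lp ℝ 2 P, Integrable (fun ω => Complex.exp (t * ξ ω * Complex.I)) P := by
    intro ξ
    refine Integrable.of_bound (C := 1) ?_ (ae_of_all _ fun ω => ?_)
    · have := aemeasurable_Lp ξ
      exact AEMeasurable.aestronglyMeasurable (by fun_prop)
    · rw [← Complex.ofReal_mul, Complex.norm_exp_ofReal_mul_I]
  have hsub : Integrable (ξ - η : Lp ℝ 2 P) P := (Lp.memLp (ξ - η)).integrable one_le_two
  have hb : ∫ ω, ‖(ξ - η : Lp ℝ 2 P) ω‖ ∂P ≤ ‖ξ - η‖ := by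
    rw [Lp.norm_def, integral_norm_eq_lintegral_enorm (Lp.aestronglyMeasurable _),
      ← eLpNorm_one_eq_lintegral_enorm]
    exact ENNReal.toReal_mono (Lp.eLpNorm_ne_top _)
      (eLpNorm_le_eLpNorm_of_exponent_le one_le_two (Lp.aestronglyMeasurable _))
  rw [dist_eq_norm, dist_eq_norm, hrep, hrep, ← integral_sub (hint ξ) (hint η)]
  refine (norm_integral_le_integral_norm _).trans ?_
  refine le_trans ?_ (mul_le_mul_of_nonneg_left hb (by simp))
  rw [← integral_const_mul]
  refine integral_mono_ae ((hint ξ).sub (hint η)).norm (hsub.norm.const_mul _) ?_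
  filter_upwards [Lp.coeFn_sub ξ η] with ω hω
  rw [hω, Pi.sub_apply]
  have h1 : Complex.exp (t * ξ ω * Complex.I) - Complex.exp (t * η ω * Complex.I) =
      Complex.exp ((t * η ω : ℝ) * Complex.I) *
        (Complex.exp (Complex.I * (t * (ξ ω - η ω) : ℝ)) - 1) := by
    rw [mul_sub, ← Complex.exp_add, mul_one]
    push_cast
    congr 2
    ring
  rw [h1, norm_mul, Complex.norm_exp_ofReal_mul_I, one_mul]
  refine Real.norm_exp_I_mul_ofReal_sub_one_le.trans ?_
  rw [norm_mul]
  rfl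

/-- Limits of centred Gaussian variables are centred Gaussian. -/
theorem IsGaussianSubmodule.topologicalClosure
    (hH : IsGaussianSubmodule H) : IsGaussianSubmodule H.topologicalClosure := by
  have key : ∀ ξ : Lp ℝ 2 P, P.map ξ = gaussianReal 0 (‖ξ‖₊ ^ 2) ↔
      ∀ t : ℝ, charFun (P.map ξ) t = Complex.exp (-(((‖ξ‖ : ℝ) : ℂ) ^ 2 * t ^ 2 / 2)) := by
    intro ξ
    have hp : IsProbabilityMeasure (P.map ξ) := Measure.isProbabilityMeasure_map (aemeasurable_Lp ξ)
    have h1 : ∀ t : ℝ, charFun (gaussianReal 0 (‖ξ‖₊ ^ 2)) t =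
        Complex.exp (-(((‖ξ‖ : ℝ) : ℂ) ^ 2 * t ^ 2 / 2)) := by
      intro t
      rw [charFun_gaussianReal]
      simp
    constructor
    · intro h t
      rw [h, h1]
    · intro h
      refine Measure.ext_of_charFun ?_
      ext t
      rw [h, h1]
  -- Through characteristic functions, being centred Gaussian becomes, for each t, an equality of
  -- two continuous functions of ξ.
  have hcl : IsClosed {ξ : Lp ℝ 2 P | P.map ξ = gaussianReal 0 (‖ξ‖₊ ^ 2)} := by
    simp_rw [key, Set.ofPred_forall]
    refine isClosed_iInter fun t => isClosed_eq (continuous_charFun_map t) ?_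
    fun_prop
  intro ξ hξ
  exact closure_minimal (s := (H : Set (Lp ℝ 2 P))) (fun η hη => hH η hη) hcl hξ

/-- An element of the linear span involves finitely many sites, whose joint law is Gaussian; the
closure is covered by stability under limits. -/
theorem isGaussianSubmodule_gaussianSpace {L : Type*} {G : Matrix L L ℝ} (hG : G.PosDef)
    {φ : L → Ω → ℝ} (hφ : IsGaussianField P G φ) :
    IsGaussianSubmodule (gaussianSpace P φ) := by
  classical
  refine IsGaussianSubmodule.topologicalClosure ?_
  intro ξ hξ
  have hmem : ∀ x, MemLp (φ x) 2 P := by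
    intro x
    obtain ⟨T, hT, hg, -⟩ := hφ.exists_law hG {x}
    exact (hg.eval ⟨x, hT (by simp)⟩).memLp_two
  have hset : {F : Lp ℝ 2 P | ∃ x, F =ᵐ[P] φ x} = Set.range fun x => (hmem x).toLp (φ x) := by
    ext F
    constructor
    · rintro ⟨x, hx⟩
      exact ⟨x, Lp.ext ((hmem x).coeFn_toLp.trans hx.symm)⟩
    · rintro ⟨x, rfl⟩
      exact ⟨x, (hmem x).coeFn_toLp⟩
  rw [hset, Finsupp.mem_span_range_iff_exists_finsupp] at hξ
  obtain ⟨c, rfl⟩ := hξ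
  obtain ⟨T, hT, hg, h0, -⟩ := hφ.exists_law hG c.support
  set ξ := c.sum fun i a => a • (hmem i).toLp (φ i) with hξ
  have hae : (ξ : Ω → ℝ) =ᵐ[P] fun ω => ∑ t : T, c t * φ t ω := by
    have h1 : ξ = ∑ t ∈ T, c t • (hmem t).toLp (φ t) :=
      Finsupp.sum_of_support_subset _ hT _ (by simp)
    have h2 : ∀ᵐ ω ∂P, ∀ t : T, (hmem t).toLp (φ t) ω = φ t ω :=
      ae_all_iff.2 fun t => (hmem t).coeFn_toLp
    rw [h1]
    filter_upwards [coeFn_sum_smul T (fun t => c t) fun t => (hmem t).toLp (φ t), h2] with ω h3 h4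
    rw [h3, ← Finset.sum_coe_sort T]
    exact Finset.sum_congr rfl fun t _ => by rw [h4]
  have hgl : HasGaussianLaw ξ P := by
    have hL := hg.map_fun (∑ t : T, c t • ContinuousLinearMap.proj (R := ℝ) (φ := fun _ : T => ℝ) t)
    refine hL.congr (hae.symm.mono fun ω hω => ?_)
    rw [← hω]
    simp
  refine map_eq_gaussianReal_of_hasGaussianLaw hgl ?_
  rw [integral_congr_ae hae, integral_finsetSum]
  · exact Finset.sum_eq_zero fun t _ => by rw [integral_const_mul, h0 t t.2, mul_zero]
  · exact fun t _ => ((hmem t).integrable one_le_two).const_mul _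

/-- For jointly Gaussian vectors zero covariance means independence. The index type `Option ι`
carries the joint vector, with ξ at `none`. -/
theorem IsGaussianSubmodule.indepFun (hH : IsGaussianSubmodule H) {ι : Type*} [Fintype ι]
    {ξ : Lp ℝ 2 P} (hξ : ξ ∈ H) {ζ : ι → Lp ℝ 2 P} (hζ : ∀ i, ζ i ∈ H)
    (h : ∀ i, inner ℝ ξ (ζ i) = 0) : IndepFun ξ (fun ω i => ζ i ω) P := by
  have hjoint := hH.hasGaussianLaw (η := fun o : Option ι => o.elim ξ ζ)
    (by rintro (_ | i); exacts [hξ, hζ i])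
  have h2 := hjoint.map_fun ((ContinuousLinearMap.pi fun _ : Unit =>
      ContinuousLinearMap.proj (R := ℝ) (φ := fun _ : Option ι => ℝ) none).prod
    (ContinuousLinearMap.pi fun i : ι =>
      ContinuousLinearMap.proj (R := ℝ) (φ := fun _ : Option ι => ℝ) (some i)))
  have h3 := HasGaussianLaw.indepFun_of_covariance_eval (X := fun _ : Unit => ξ)
    (Y := fun i => ζ i) (P := P) h2 (fun _ i => by
      rw [covariance_eq_sub (Lp.memLp ξ) (Lp.memLp (ζ i)), hH.integral_eq_zero hξ, zero_mul,
        sub_zero]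
      simpa [real_inner_eq_integral] using h i)
  exact h3.comp (φ := fun u : Unit → ℝ => u ()) (ψ := id) (by fun_prop) measurable_id

/-- Gaussian integration by parts. -/
theorem IsGaussianSubmodule.integral_mul_eval (hH : IsGaussianSubmodule H) {ι : Type*} [Fintype ι]
    {η : ι → Lp ℝ 2 P} (hη : ∀ i, η i ∈ H) (i : ι) (p : MvPolynomial ι ℝ) :
    ∫ ω, η i ω * MvPolynomial.eval (fun j => η j ω) p ∂P =
      ∑ j, inner ℝ (η i) (η j) *
        ∫ ω, MvPolynomial.eval (fun j => η j ω) (MvPolynomial.pderiv j p) ∂P := by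
  -- The zero variable is separated because the regression coefficients divide by its variance.
  by_cases hi : η i = 0
  · rw [hi]
    simp only [inner_zero_left, zero_mul, Finset.sum_const_zero]
    refine integral_eq_zero_of_ae ?_
    filter_upwards [Lp.coeFn_zero ℝ 2 P] with ω hω
    simp
  set v : ℝ≥0 := ‖η i‖₊ ^ 2 with hv
  have hv0 : (v : ℝ) ≠ 0 := by simp [hv, hi]
  have hvn : inner ℝ (η i) (η i) = (v : ℝ) := by
    rw [real_inner_self_eq_norm_sq, hv]; simp
  -- Regression on η_i: the residuals ζ_j = η_j - c_j η_i are orthogonal to η_i, hence independent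
  -- of it. With ζ frozen, the integral over η_i runs along a line.
  set c : ι → ℝ := fun j => inner ℝ (η i) (η j) / v with hc
  set ζ : ι → Lp ℝ 2 P := fun j => η j - c j • η i with hζ
  have hζH : ∀ j, ζ j ∈ H := fun j => H.sub_mem (hη j) (H.smul_mem _ (hη i))
  have hind : IndepFun (η i) (fun ω j => ζ j ω) P := by
    refine hH.indepFun (hη i) hζH fun j => ?_
    rw [hζ, inner_sub_right, inner_smul_right, hvn, hc]
    field_simp
    simp
  have hmi : AEMeasurable (η i) P := aemeasurable_Lp _
  have hmζ : AEMeasurable (fun ω j => ζ j ω) P :=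
    aemeasurable_pi_lambda _ fun j => aemeasurable_Lp _
  have hpair := hind.map_prod_eq_prod_map_map hmi hmζ
  have hae : ∀ᵐ ω ∂P, ∀ j, η j ω = c j * η i ω + ζ j ω := by
    refine ae_all_iff.2 fun j => ?_
    filter_upwards [Lp.coeFn_sub (η j) (c j • η i), Lp.coeFn_smul (c j) (η i)] with ω h1 h2
    simp only [hζ]
    rw [h1, Pi.sub_apply, h2]
    simp
  have hpi : IsProbabilityMeasure (P.map (η i)) := Measure.isProbabilityMeasure_map hmi
  have hpζ : IsProbabilityMeasure (P.map fun ω j => ζ j ω) := Measure.isProbabilityMeasure_map hmζ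
  have hfub : ∀ F : ℝ × (ι → ℝ) → ℝ, Continuous F → Integrable (fun ω => F (η i ω, fun j => ζ j ω)) P →
      ∫ ω, F (η i ω, fun j => ζ j ω) ∂P =
        ∫ z, ∫ x, F (x, z) ∂gaussianReal 0 v ∂(P.map fun ω j => ζ j ω) := by
    intro F hF hFi
    have hmp := hmi.prodMk hmζ
    have h1 : ∫ ω, F (η i ω, fun j => ζ j ω) ∂P =
        ∫ y, F y ∂(P.map fun ω => (η i ω, fun j => ζ j ω)) := by
      rw [integral_map hmp hF.aestronglyMeasurable]
    have h2 : Integrable F (P.map fun ω => (η i ω, fun j => ζ j ω)) := by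
      rw [integrable_map_measure hF.aestronglyMeasurable hmp]
      exact hFi
    rw [hpair] at h1 h2
    rw [h1, integral_prod_symm _ h2, hH _ (hη i)]
  have hmom : ∀ j, HasAllMoments P (η j) := fun j => hH.hasAllMoments (hη j)
  have hcont : ∀ r : MvPolynomial ι ℝ, Continuous fun y : ℝ × (ι → ℝ) =>
      MvPolynomial.eval (fun j => c j * y.1 + y.2 j) r := by
    intro r
    exact (MvPolynomial.continuous_eval r).comp (by fun_prop)
  have hsub : ∀ r : MvPolynomial ι ℝ, (fun ω => MvPolynomial.eval (fun j => η j ω) r) =ᵐ[P]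
      fun ω => MvPolynomial.eval (fun j => c j * η i ω + ζ j ω) r := by
    intro r
    filter_upwards [hae] with ω hω
    congr 2
    exact funext hω
  have hm := fun r => (HasAllMoments.mvPolynomial_eval hmom r).congr (hsub r)
  have hL : (fun ω => η i ω * MvPolynomial.eval (fun j => η j ω) p) =ᵐ[P]
      fun ω => η i ω * MvPolynomial.eval (fun j => c j * η i ω + ζ j ω) p :=
    (hsub p).mono fun ω hω => by simp only [hω]
  rw [integral_congr_ae hL,
    hfub (fun y => y.1 * MvPolynomial.eval (fun j => c j * y.1 + y.2 j) p)
      (continuous_fst.mul (hcont p)) ((hmom i).mul (hm p)).integrable]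
  simp_rw [integral_mul_mvPolynomial_eval_gaussianReal]
  rw [integral_const_mul, ← hfub (fun y => ∑ j, c j *
      MvPolynomial.eval (fun j => c j * y.1 + y.2 j) (MvPolynomial.pderiv j p))
    (continuous_finsetSum _ fun j _ => (hcont _).const_smul (c j))
    (integrable_finsetSum _ fun j _ => (hm _).integrable.const_mul _),
    integral_finsetSum _ (fun j _ => (hm _).integrable.const_mul _), Finset.mul_sum]
  refine Finset.sum_congr rfl fun j _ => ?_
  rw [integral_const_mul, integral_congr_ae (hsub (MvPolynomial.pderiv j p)), ← mul_assoc]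
  congr 1
  simp only [hc]
  field_simp

end GaussianSpace

/-! ### Hermite polynomials of a given variance -/

section Hermite

open Polynomial

/-- The monic Hermite polynomials for the variance `v`. -/
def hermiteVar (v : ℝ) : ℕ → ℝ[X]
  | 0 => 1
  | 1 => X
  | n + 2 => X * hermiteVar v (n + 1) - C ((n + 1 : ℝ) * v) * hermiteVar v n

/-- One formula covers all n: at n = 0 the truncated `n - 1` is multiplied by 0. -/
theorem hermiteVar_succ (v : ℝ) (n : ℕ) :
    hermiteVar v (n + 1) = X * hermiteVar v n - C ((n : ℝ) * v) * hermiteVar v (n - 1) := by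
  cases n with
  | zero => simp [hermiteVar]
  | succ n => simp [hermiteVar]

theorem derivative_hermiteVar (v : ℝ) (n : ℕ) :
    derivative (hermiteVar v n) = C (n : ℝ) * hermiteVar v (n - 1) := by
  induction n using Nat.strong_induction_on with
  | _ n ih =>
    match n with
    | 0 => simp [hermiteVar]
    | 1 => simp [hermiteVar]
    | n + 2 =>
      have h1 := ih (n + 1) (by omega)
      have h2 := ih n (by omega)
      have h3 := hermiteVar_succ v n
      simp only [Nat.add_sub_cancel] at h1
      rw [hermiteVar, derivative_sub, derivative_mul, h1, derivative_C_mul, h2, derivative_X,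
        show n + 2 - 1 = n + 1 from rfl, h3]
      simp only [C_mul, Nat.cast_add, Nat.cast_one, Nat.cast_ofNat, C_add, map_natCast, C_1]
      rw [show (C (2 : ℝ) : ℝ[X]) = 2 from rfl]
      ring

theorem natDegree_hermiteVar_le (v : ℝ) (n : ℕ) : (hermiteVar v n).natDegree ≤ n := by
  induction n using Nat.strong_induction_on with
  | _ n ih =>
    match n with
    | 0 => simp [hermiteVar]
    | 1 => simp [hermiteVar]
    | n + 2 =>
      rw [hermiteVar]
      refine (natDegree_sub_le _ _).trans (max_le ?_ ?_)
      · have := ih (n + 1) (by omega)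
        have := natDegree_mul_le (p := (X : ℝ[X])) (q := hermiteVar v (n + 1))
        simp only [natDegree_X] at this
        omega
      · have := ih n (by omega)
        have := natDegree_C_mul_le ((n + 1 : ℝ) * v) (hermiteVar v n)
        omega

/-- The leading terms cancel in each step of the recursion. This is what puts the remainder of a
power below its chaos. -/
theorem natDegree_X_pow_sub_hermiteVar_le (v : ℝ) (n : ℕ) :
    (X ^ (n + 1) - hermiteVar v (n + 1)).natDegree ≤ n := by
  induction n with
  | zero => simp [hermiteVar]
  | succ n ih =>
    have h : X ^ (n + 2) - hermiteVar v (n + 2) =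
        X * (X ^ (n + 1) - hermiteVar v (n + 1)) + C ((n + 1 : ℝ) * v) * hermiteVar v n := by
      rw [hermiteVar]; ring
    rw [h]
    refine natDegree_add_le_of_degree_le ?_ ?_
    · have := natDegree_mul_le (p := (X : ℝ[X])) (q := X ^ (n + 1) - hermiteVar v (n + 1))
      simp only [natDegree_X] at this
      omega
    · have := natDegree_hermiteVar_le v n
      have := natDegree_C_mul_le ((n + 1 : ℝ) * v) (hermiteVar v n)
      omega

end Hermite

/-! ### Hermite polynomials under integration by parts -/

section SteinFunctional

open MvPolynomial

variable {ι : Type*} [Fintype ι]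

/-- A linear functional on polynomials that satisfies Gaussian integration by parts for the
covariance `C`. -/
def IsSteinFunctional (C : ι → ι → ℝ) (E : MvPolynomial ι ℝ →ₗ[ℝ] ℝ) : Prop :=
  ∀ i p, E (X i * p) = ∑ j, C i j * E (pderiv j p)

/-- The Hermite polynomial of degree `n` in the `i`-th variable. -/
def hermiteX (v : ℝ) (i : ι) (n : ℕ) : MvPolynomial ι ℝ := Polynomial.aeval (X i) (hermiteVar v n)

omit [Fintype ι] in
theorem hermiteX_zero (v : ℝ) (i : ι) : hermiteX v i 0 = 1 := by simp [hermiteX, hermiteVar]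

omit [Fintype ι] in
theorem hermiteX_succ (v : ℝ) (i : ι) (n : ℕ) :
    hermiteX v i (n + 1) = X i * hermiteX v i n - ((n : ℝ) * v) • hermiteX v i (n - 1) := by
  simp [hermiteX, hermiteVar_succ, smul_eq_C_mul]

omit [Fintype ι] in
theorem pderiv_hermiteX_self (v : ℝ) (i : ι) (n : ℕ) :
    pderiv i (hermiteX v i n) = (n : ℝ) • hermiteX v i (n - 1) := by
  simp [hermiteX, derivative_hermiteVar, Derivation.map_aeval, smul_eq_C_mul]

omit [Fintype ι] in
theorem pderiv_hermiteX_of_ne (v : ℝ) {i j : ι} (h : j ≠ i) (n : ℕ) :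
    pderiv j (hermiteX v i n) = 0 := by
  simp [hermiteX, Derivation.map_aeval, pderiv_X_of_ne h.symm]

variable {C : ι → ι → ℝ} {E : MvPolynomial ι ℝ →ₗ[ℝ] ℝ}

/-- Integrate `X i` by parts. The derivative of the Hermite factor contributes only for j = i, and
that contribution, n C_ii E[h_{n-1} p], is what the recursion subtracts. Wick ordering thus removes
self-contractions. -/
theorem IsSteinFunctional.hermiteX_mul (hE : IsSteinFunctional C E) (i : ι) (n : ℕ)
    (p : MvPolynomial ι ℝ) :
    E (hermiteX (C i i) i (n + 1) * p) = ∑ j, C i j * E (hermiteX (C i i) i n * pderiv j p) := by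
  classical
  rw [hermiteX_succ, sub_mul, mul_assoc, map_sub, hE i]
  simp only [Derivation.leibniz, smul_eq_mul, map_add, mul_add, Finset.sum_add_distrib]
  rw [add_sub_assoc, add_eq_left, sub_eq_zero, Finset.sum_eq_single i]
  · rw [pderiv_hermiteX_self]
    simp only [smul_mul_assoc, mul_smul_comm, map_smul, smul_eq_mul]
    rw [mul_comm p]
    ring
  · intro j _ hj
    rw [pderiv_hermiteX_of_ne _ hj]
    simp
  · simp

/-- Each lowering of the Hermite degree costs the monomial one derivative, and the monomial has
fewer derivatives to give than the Hermite degree demands. -/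
theorem IsSteinFunctional.hermiteX_mul_monomial_eq_zero (hE : IsSteinFunctional C E) (i : ι)
    (n : ℕ) (s : ι →₀ ℕ) (hs : s.degree ≤ n) (c : ℝ) :
    E (hermiteX (C i i) i (n + 1) * monomial s c) = 0 := by
  induction n generalizing s c with
  | zero =>
    have : s = 0 := (Finsupp.degree_eq_zero_iff s).1 (by omega)
    rw [hE.hermiteX_mul]
    refine Finset.sum_eq_zero fun j _ => ?_
    simp [this]
  | succ n ih =>
    rw [hE.hermiteX_mul]
    refine Finset.sum_eq_zero fun j _ => ?_
    rw [pderiv_monomial]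
    by_cases hj : s j = 0
    · simp [hj]
    · rw [ih, mul_zero]
      have h1 : s - Finsupp.single j 1 + Finsupp.single j 1 = s := by
        refine tsub_add_cancel_of_le ?_
        simpa using Nat.one_le_iff_ne_zero.2 hj
      have h2 := congrArg Finsupp.degree h1
      rw [map_add, Finsupp.degree_single] at h2
      omega

theorem IsSteinFunctional.hermiteX_mul_eq_zero (hE : IsSteinFunctional C E) (i : ι) (n : ℕ)
    (p : MvPolynomial ι ℝ) (hp : p.totalDegree ≤ n) :
    E (hermiteX (C i i) i (n + 1) * p) = 0 := by
  rw [← support_sum_monomial_coeff p, Finset.mul_sum, map_sum]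
  refine Finset.sum_eq_zero fun s hs => hE.hermiteX_mul_monomial_eq_zero i n s ?_ _
  exact (le_totalDegree hs).trans hp

end SteinFunctional

/-! ### Wick powers are Hermite polynomials -/

section Wick

variable {Ω : Type*} [MeasurableSpace Ω] {P : Measure Ω} [IsProbabilityMeasure P]

/-- Expectation of a polynomial in random variables with moments of all orders. -/
def polyExpectation {ι : Type*} {f : ι → Ω → ℝ} (hf : ∀ i, HasAllMoments P (f i)) :
    MvPolynomial ι ℝ →ₗ[ℝ] ℝ where
  toFun p := ∫ ω, MvPolynomial.eval (fun i => f i ω) p ∂P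
  map_add' p q := by
    simp only [map_add]
    exact integral_add (HasAllMoments.mvPolynomial_eval hf p).integrable
      (HasAllMoments.mvPolynomial_eval hf q).integrable
  map_smul' c p := by
    simp only [MvPolynomial.smul_eval, RingHom.id_apply, smul_eq_mul]
    exact integral_const_mul _ _

theorem polyExpectation_apply {ι : Type*} {f : ι → Ω → ℝ} (hf : ∀ i, HasAllMoments P (f i))
    (p : MvPolynomial ι ℝ) :
    polyExpectation hf p = ∫ ω, MvPolynomial.eval (fun i => f i ω) p ∂P := rfl

theorem IsGaussianSubmodule.isSteinFunctional {H : Submodule ℝ (Lp ℝ 2 P)}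
    (hH : IsGaussianSubmodule H) {ι : Type*} [Fintype ι] {η : ι → Lp ℝ 2 P} (hη : ∀ i, η i ∈ H) :
    IsSteinFunctional (fun i j => inner ℝ (η i) (η j))
      (polyExpectation fun i => hH.hasAllMoments (hη i)) := by
  intro i p
  simpa [polyExpectation_apply] using hH.integral_mul_eval hη i p

theorem eval_aeval_X {ι : Type*} (p : Polynomial ℝ) (i : ι) (y : ι → ℝ) :
    MvPolynomial.eval y (Polynomial.aeval (MvPolynomial.X i) p) = p.eval (y i) := by
  rw [← MvPolynomial.coe_aeval_eq_eval, RingHom.coe_coe, ← Polynomial.aeval_algHom_apply,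
    MvPolynomial.aeval_X, Polynomial.coe_aeval_eq_eval]

theorem eval_hermiteX {ι : Type*} (v : ℝ) (i : ι) (n : ℕ) (y : ι → ℝ) :
    MvPolynomial.eval y (hermiteX v i n) = (hermiteVar v n).eval (y i) := eval_aeval_X _ _ _

theorem totalDegree_aeval_X_le {ι : Type*} (i : ι) (p : Polynomial ℝ) :
    (Polynomial.aeval (MvPolynomial.X i : MvPolynomial ι ℝ) p).totalDegree ≤ p.natDegree := by
  rw [Polynomial.aeval_eq_sum_range]
  refine MvPolynomial.totalDegree_finsetSum_le fun n hn => ?_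
  refine (MvPolynomial.totalDegree_smul_le _ _).trans ?_
  rw [MvPolynomial.totalDegree_X_pow]
  exact Nat.lt_succ_iff.1 (Finset.mem_range.1 hn)

variable {H : Submodule ℝ (Lp ℝ 2 P)}

omit [IsProbabilityMeasure P] in
theorem toLp_eval_mem_polyClosure {ξ : Lp ℝ 2 P} (hξ : ξ ∈ H) (p : Polynomial ℝ) {n : ℕ}
    (hp : p.natDegree ≤ n) {F : Lp ℝ 2 P} (hF : F =ᵐ[P] fun ω => p.eval (ξ ω)) :
    F ∈ polyClosure H n := by
  refine Submodule.le_topologicalClosure _ (Submodule.subset_span ?_)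
  refine ⟨1, fun _ => ⟨ξ, hξ⟩, Polynomial.aeval (MvPolynomial.X 0) p,
    (totalDegree_aeval_X_le _ _).trans hp, hF.trans (ae_of_all _ fun ω => ?_)⟩
  exact (eval_aeval_X p 0 fun _ : Fin 1 => ξ ω).symm

/-- A spanning polynomial involves finitely many variables. Adjoin ξ to them at index `none` and use
orthogonality under the resulting functional; taking the closure does not change the orthogonal
complement. -/
theorem IsGaussianSubmodule.hermite_mem_orthogonal (hH : IsGaussianSubmodule H) {ξ : Lp ℝ 2 P}
    (hξ : ξ ∈ H) (n : ℕ) {F : Lp ℝ 2 P}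
    (hF : F =ᵐ[P] fun ω => (hermiteVar (inner ℝ ξ ξ) (n + 1)).eval (ξ ω)) :
    F ∈ (polyClosure H n)ᗮ := by
  rw [polyClosure, Submodule.orthogonal_closure, Submodule.mem_orthogonal]
  have hle : Submodule.span ℝ {F : Lp ℝ 2 P | ∃ (m : ℕ) (ξ : Fin m → H) (p : MvPolynomial (Fin m) ℝ),
      p.totalDegree ≤ n ∧ F =ᵐ[P] fun ω => MvPolynomial.eval (fun i => (ξ i : Lp ℝ 2 P) ω) p} ≤
        (Submodule.span ℝ {F})ᗮ := by
    refine Submodule.span_le.2 ?_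
    rintro K ⟨m, ζ, p, hp, hK⟩
    rw [SetLike.mem_coe, Submodule.mem_orthogonal_singleton_iff_inner_right]
    have hη : ∀ o : Option (Fin m), (o.elim ξ fun i => (ζ i : Lp ℝ 2 P)) ∈ H := by
      rintro (_ | i)
      exacts [hξ, (ζ i).2]
    have h0 := (hH.isSteinFunctional hη).hermiteX_mul_eq_zero none n (MvPolynomial.rename some p)
      ((MvPolynomial.totalDegree_rename_le _ _).trans hp)
    rw [← h0, polyExpectation_apply, real_inner_eq_integral]
    refine integral_congr_ae ?_
    filter_upwards [hF, hK] with ω h1 h2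
    rw [h1, h2, map_mul, eval_hermiteX, MvPolynomial.eval_rename]
    rfl
  intro K hK
  rw [real_inner_comm]
  exact Submodule.mem_orthogonal_singleton_iff_inner_right.1 (hle hK)

/-- For positive degree, the power is its Hermite polynomial, which lies in the chaos, plus a
polynomial of lower degree, to which the chaos is orthogonal by definition. -/
theorem IsGaussianSubmodule.starProjection_pow (hH : IsGaussianSubmodule H) {ξ : Lp ℝ 2 P}
    (hξ : ξ ∈ H) (n : ℕ) {F : Lp ℝ 2 P} (hF : F =ᵐ[P] fun ω => ξ ω ^ n) :
    (chaos H n).starProjection F =ᵐ[P] fun ω => (hermiteVar (inner ℝ ξ ξ) n).eval (ξ ω) := by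
  cases n with
  | zero =>
    have hmem : F ∈ chaos H 0 := toLp_eval_mem_polyClosure hξ 1 (by simp) (by simpa using hF)
    rw [Submodule.starProjection_eq_self_iff.2 hmem]
    simpa [hermiteVar] using hF
  | succ n =>
    have hmom := (hH.hasAllMoments hξ).polynomial_eval (hermiteVar (inner ℝ ξ ξ) (n + 1))
    have hmem := hmom 2 (by simp)
    have hQ := hmem.coeFn_toLp
    have h := Submodule.eq_starProjection_of_mem_orthogonal (K := chaos H (n + 1)) (u := F)
      (v := hmem.toLp _)
      ⟨toLp_eval_mem_polyClosure hξ _ (natDegree_hermiteVar_le _ _) hQ,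
        hH.hermite_mem_orthogonal hξ n hQ⟩ ?_
    · rw [h]
      exact hQ
    · have hr : F - hmem.toLp _ ∈ polyClosure H n := by
        refine toLp_eval_mem_polyClosure hξ _
          (natDegree_X_pow_sub_hermiteVar_le (inner ℝ ξ ξ) n) ?_
        filter_upwards [Lp.coeFn_sub F (hmem.toLp _), hQ, hF] with ω h1 h2 h3
        rw [h1, Pi.sub_apply, h2, h3]
        simp
      exact Submodule.orthogonal_le inf_le_right (Submodule.le_orthogonal_orthogonal _ hr)

end Wick

/-! ### Counting the Feynman diagrams of a multigraph -/

section FeynmanCount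

/-- The bijections onto a disjoint union with a prescribed first component are given by bijections
of the fibres. -/
def equivSigmaFiber {V κ : Type*} {B : κ → Type*} (t : V → κ) :
    {e : V ≃ Σ j, B j // ∀ v, (e v).1 = t v} ≃ ∀ j, ({v // t v = j} ≃ B j) where
  toFun e j := (e.1.subtypeEquiv (q := fun w => w.1 = j) fun v => by rw [e.2]).trans
    (Equiv.sigmaSubtype j)
  invFun f := ⟨(Equiv.sigmaFiberEquiv t).symm.trans (Equiv.sigmaCongrRight f), fun v => rfl⟩
  left_inv e := by
    ext v : 2
    refine Sigma.ext (e.2 v).symm ?_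
    obtain ⟨e, he⟩ := e
    have h1 : ∀ (w : Σ j, B j) (j : κ) (h : w.1 = j), HEq (Equiv.sigmaSubtype j ⟨w, h⟩) w.2 := by
      rintro w j rfl
      rfl
    exact h1 (e v) (t v) (he v)
  right_inv f := by
    ext j v
    obtain ⟨v, rfl⟩ := v
    rfl

/-- Count the bijections from `V` to the disjoint union of the `Fin (q j)` twice: directly, and by
first choosing the component of each image and then a bijection on each fibre. -/
theorem card_fiber_eq_mul_prod_factorial {V κ : Type*} [Fintype V] [Fintype κ] [DecidableEq V]
    [DecidableEq κ] (q : κ → ℕ) (hq : ∑ j, q j = Fintype.card V) :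
    Fintype.card {t : V → κ // ∀ j, (Finset.univ.filter fun s => t s = j).card = q j} *
      ∏ j, (q j).factorial = (Fintype.card V).factorial := by
  have h1 : (Fintype.card V).factorial = Fintype.card (V ≃ Σ j, Fin (q j)) := by
    rw [Fintype.card_equiv (Fintype.equivOfCardEq (by simp [hq]))]
  have h2 : (V ≃ Σ j, Fin (q j)) ≃
      Σ t : {t : V → κ // ∀ j, (Finset.univ.filter fun s => t s = j).card = q j},
        {e : V ≃ Σ j, Fin (q j) // ∀ v, (e v).1 = t.1 v} :=
    { toFun e := ⟨⟨fun v => (e v).1, fun j => by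
        rw [← Fintype.card_subtype, Fintype.card_congr
          ((e.subtypeEquiv (q := fun w => w.1 = j) fun v => Iff.rfl).trans (Equiv.sigmaSubtype j)),
          Fintype.card_fin]⟩, e, fun v => rfl⟩
      invFun x := x.2.1
      left_inv e := rfl
      right_inv := by
        rintro ⟨⟨t, ht⟩, e, he⟩
        obtain rfl : (fun v => (e v).1) = t := funext he
        rfl }
  rw [h1, Fintype.card_congr h2, Fintype.card_sigma, ← Finset.card_univ, ← smul_eq_mul,
    ← Finset.sum_const]
  refine Finset.sum_congr rfl fun t _ => ?_
  rw [Fintype.card_congr (equivSigmaFiber t.1), Fintype.card_pi]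
  refine Finset.prod_congr rfl fun j _ => ?_
  rw [Fintype.card_equiv (Fintype.equivOfCardEq (by rw [Fintype.card_subtype, t.2, Fintype.card_fin])),
    Fintype.card_subtype, t.2]

section Involution

variable {V κ : Type*} [LinearOrder κ] (c τ : V → κ)

/-- Bijections between the points of colour `i` and type `j` and those of colour `j` and type `i`,
for all `i < j`. -/
abbrev PairMatchings := ∀ p : {p : κ × κ // p.1 < p.2},
  ({v // c v = p.1.1 ∧ τ v = p.1.2} ≃ {v // c v = p.1.2 ∧ τ v = p.1.1})

variable {c τ}

/-- The involution that a family of matchings defines. -/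
def PairMatchings.toFun (hne : ∀ v, τ v ≠ c v) (f : PairMatchings c τ) (v : V) : V :=
  if h : c v < τ v then (f ⟨(c v, τ v), h⟩ ⟨v, rfl, rfl⟩).1
  else ((f ⟨(τ v, c v), lt_of_le_of_ne (not_lt.1 h) (hne v)⟩).symm ⟨v, rfl, rfl⟩).1

theorem PairMatchings.toFun_eq (hne : ∀ v, τ v ≠ c v) (f : PairMatchings c τ)
    {a b : κ} (h : a < b) (v : V) (hv : c v = a ∧ τ v = b) :
    f.toFun hne v = (f ⟨(a, b), h⟩ ⟨v, hv⟩).1 := by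
  have h1 := hv.1
  have h2 := hv.2
  subst h1 h2
  exact dif_pos h

theorem PairMatchings.toFun_eq_symm (hne : ∀ v, τ v ≠ c v) (f : PairMatchings c τ)
    {a b : κ} (h : a < b) (v : V) (hv : c v = b ∧ τ v = a) :
    f.toFun hne v = ((f ⟨(a, b), h⟩).symm ⟨v, hv⟩).1 := by
  have h1 := hv.1
  have h2 := hv.2
  subst h1 h2
  exact dif_neg (not_lt.2 h.le)

theorem PairMatchings.toFun_spec (hne : ∀ v, τ v ≠ c v) (f : PairMatchings c τ) (v : V) :
    f.toFun hne (f.toFun hne v) = v ∧ c (f.toFun hne v) = τ v := by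
  rcases lt_or_gt_of_ne (hne v) with h | h
  · have h1 := f.toFun_eq_symm hne h v ⟨rfl, rfl⟩
    have h2 := ((f ⟨(τ v, c v), h⟩).symm ⟨v, rfl, rfl⟩).2
    rw [h1]
    refine ⟨?_, h2.1⟩
    rw [f.toFun_eq hne h _ h2]
    simp
  · have h1 := f.toFun_eq hne h v ⟨rfl, rfl⟩
    have h2 := (f ⟨(c v, τ v), h⟩ ⟨v, rfl, rfl⟩).2
    rw [h1]
    refine ⟨?_, h2.1⟩
    rw [f.toFun_eq_symm hne h _ h2]
    simp

/-- The matchings that an involution defines. -/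
def PairMatchings.ofInvolution
    (γ : {γ : Equiv.Perm V // (∀ v, γ (γ v) = v) ∧ ∀ v, c (γ v) = τ v}) : PairMatchings c τ :=
  fun _ =>
    { toFun v := ⟨γ.1 v, by rw [γ.2.2, v.2.2], by rw [← γ.2.2, γ.2.1, v.2.1]⟩
      invFun v := ⟨γ.1 v, by rw [γ.2.2, v.2.2], by rw [← γ.2.2, γ.2.1, v.2.1]⟩
      left_inv v := Subtype.ext (γ.2.1 v)
      right_inv v := Subtype.ext (γ.2.1 v) }

/-- The involutions that send each point `v` to a point of colour `τ v`. -/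
def involutionEquiv (hne : ∀ v, τ v ≠ c v) :
    {γ : Equiv.Perm V // (∀ v, γ (γ v) = v) ∧ ∀ v, c (γ v) = τ v} ≃ PairMatchings c τ where
  toFun := PairMatchings.ofInvolution
  invFun f := ⟨Function.Involutive.toPerm (f.toFun hne) fun v => (f.toFun_spec hne v).1,
    fun v => (f.toFun_spec hne v).1, fun v => (f.toFun_spec hne v).2⟩
  left_inv γ := by
    ext v
    rcases lt_or_gt_of_ne (hne v) with h | h
    · exact PairMatchings.toFun_eq_symm hne (.ofInvolution γ) h v ⟨rfl, rfl⟩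
    · exact PairMatchings.toFun_eq hne (.ofInvolution γ) h v ⟨rfl, rfl⟩
  right_inv f := by
    ext p v
    exact f.toFun_eq hne p.2 v v.2

end Involution

/-- The pairs `i < j`. -/
def ltPairs (k : ℕ) : Finset (Fin k × Fin k) := Finset.univ.filter fun p => p.1 < p.2

theorem prod_Ioi_eq_prod_ltPairs {M : Type*} [CommMonoid M] {k : ℕ} (f : Fin k → Fin k → M) :
    ∏ i, ∏ j ∈ Finset.Ioi i, f i j = ∏ p ∈ ltPairs k, f p.1 p.2 := by
  rw [ltPairs, Finset.prod_filter, ← Finset.univ_product_univ, Finset.prod_product]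
  refine Finset.prod_congr rfl fun i _ => ?_
  rw [← Finset.prod_filter]
  refine Finset.prod_congr ?_ fun _ _ => rfl
  ext j
  simp

theorem prod_prod_eq_prod_ltPairs {M : Type*} [CommMonoid M] {k : ℕ} (f : Fin k → Fin k → M)
    (hf : ∀ i, f i i = 1) : ∏ i, ∏ j, f i j = ∏ p ∈ ltPairs k, (f p.1 p.2 * f p.2 p.1) := by
  have h1 : ∀ i j, f i j = (if i < j then f i j else 1) * (if j < i then f i j else 1) := by
    intro i j
    rcases lt_trichotomy i j with h | h | h
    · simp [h, h.le]
    · simp [h, hf]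
    · simp [h, h.le]
  have h2 : ∏ i, ∏ j, f i j = (∏ i, ∏ j, if i < j then f i j else 1) *
      ∏ i, ∏ j, if j < i then f i j else 1 := by
    simp_rw [← Finset.prod_mul_distrib, ← h1]
  rw [h2, Finset.prod_comm (f := fun i j => if j < i then f i j else 1), Finset.prod_mul_distrib,
    ltPairs, Finset.prod_filter, Finset.prod_filter, ← Finset.univ_product_univ,
    Finset.prod_product, Finset.prod_product]

/-- The number of Feynman diagrams of a multigraph. -/
theorem feynmanCount_mul_prod_factorial {k : ℕ} {n : Fin k → ℕ} {q : Fin k → Fin k → ℕ}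
    (hq : q ∈ multigraphs n) :
    feynmanCount n q * ∏ i, ∏ j ∈ Finset.Ioi i, (q i j).factorial = ∏ i, (n i).factorial := by
  obtain ⟨hs, h0, hn⟩ := mem_multigraphs.1 hq
  -- An element of `T` prescribes, for each half-edge, the vertex of its partner.
  set T := ∀ i, {t : Fin (n i) → Fin k //
    ∀ j, (Finset.univ.filter fun s => t s = j).card = q i j} with hT
  have hne : ∀ (t : T) (v : Σ i, Fin (n i)), (t v.1).1 v.2 ≠ v.1 := by
    rintro t ⟨i, s⟩ h
    have := (t i).2 i
    rw [h0, Finset.card_eq_zero] at this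
    exact Finset.notMem_empty s (this ▸ Finset.mem_filter.2 ⟨Finset.mem_univ _, h⟩)
  -- Freedom from fixed points is dropped on the right: as q_ii = 0, a partner never lies at the
  -- same vertex.
  have e1 : {γ : Equiv.Perm (Σ i : Fin k, Fin (n i)) //
      (∀ v, γ (γ v) = v) ∧ (∀ v, γ v ≠ v) ∧
        ∀ i j, (Finset.univ.filter fun s : Fin (n i) => (γ ⟨i, s⟩).1 = j).card = q i j} ≃
      Σ t : T, {γ : Equiv.Perm (Σ i : Fin k, Fin (n i)) //
        (∀ v, γ (γ v) = v) ∧ ∀ v, (γ v).1 = (t v.1).1 v.2} :=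
    { toFun γ := ⟨fun i => ⟨fun s => (γ.1 ⟨i, s⟩).1, γ.2.2.2 i⟩, γ.1, γ.2.1, fun v => rfl⟩
      invFun x := ⟨x.2.1, x.2.2.1, fun v h => hne x.1 v ((x.2.2.2 v).symm.trans (by rw [h])),
        fun i j => by
          rw [← (x.1 i).2 j]
          congr 1
          ext s
          simp only [Finset.mem_filter, Finset.mem_univ, true_and]
          rw [x.2.2.2 ⟨i, s⟩]⟩
      left_inv γ := rfl
      right_inv := by
        rintro ⟨t, γ, h1, h2⟩
        exact Sigma.subtype_ext (funext fun i => Subtype.ext (funext fun s => h2 ⟨i, s⟩)) rfl }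
  have hfib : ∀ (t : T) (i j : Fin k),
      Fintype.card {v : Σ i, Fin (n i) // v.1 = i ∧ (t v.1).1 v.2 = j} = q i j := by
    intro t i j
    rw [← (t i).2 j, ← Fintype.card_subtype]
    refine Fintype.card_congr
      { toFun v := ⟨v.2.1 ▸ v.1.2, ?_⟩
        invFun s := ⟨⟨i, s.1⟩, rfl, s.2⟩
        left_inv := ?_
        right_inv := fun s => rfl }
    · obtain ⟨⟨i', s⟩, rfl, h⟩ := v
      exact h
    · rintro ⟨⟨i', s⟩, rfl, h⟩
      rfl
  -- Once the types are fixed, a diagram is a bijection, for each i < j, between the q_ij half-edges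
  -- at i aimed at j and the q_ji = q_ij half-edges at j aimed at i.
  have h2 : feynmanCount n q = Fintype.card T * ∏ p ∈ ltPairs k, (q p.1 p.2).factorial := by
    rw [feynmanCount, Fintype.card_congr e1, Fintype.card_sigma, ← Finset.card_univ, ← smul_eq_mul,
      ← Finset.sum_const]
    refine Finset.sum_congr rfl fun t _ => ?_
    rw [Fintype.card_congr (involutionEquiv (hne t)), Fintype.card_pi, ltPairs,
      ← Finset.prod_subtype_eq_prod_filter, Finset.subtype_univ]
    refine Finset.prod_congr rfl fun p _ => ?_
    rw [Fintype.card_equiv (Fintype.equivOfCardEq _)]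
    · exact congrArg Nat.factorial (hfib t _ _)
    · exact (hfib t _ _).trans ((hs _ _).trans (hfib t _ _).symm)
  have hc : Fintype.card T = ∏ i, Fintype.card {t : Fin (n i) → Fin k //
    ∀ j, (Finset.univ.filter fun s => t s = j).card = q i j} := Fintype.card_pi
  -- The factor from the statement squares ∏_{i<j} q_ij!. By symmetry this is ∏_{i,j} q_ij!, which
  -- splits over the vertices into the multinomial counts for `T`.
  rw [prod_Ioi_eq_prod_ltPairs (fun i j => (q i j).factorial), h2, mul_assoc,
    ← Finset.prod_mul_distrib, hc]
  have h3 := prod_prod_eq_prod_ltPairs (fun i j => (q i j).factorial) (by simp [h0])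
  have h4 : ∀ p ∈ ltPairs k, (q p.1 p.2).factorial * (q p.1 p.2).factorial =
      (q p.1 p.2).factorial * (q p.2 p.1).factorial := fun p _ => by rw [hs p.2 p.1]
  rw [Finset.prod_congr rfl h4, ← h3, ← Finset.prod_mul_distrib]
  refine Finset.prod_congr rfl fun i _ => ?_
  have h5 := card_fiber_eq_mul_prod_factorial (V := Fin (n i)) (q i) (by rw [hn, Fintype.card_fin])
  rw [Fintype.card_fin] at h5
  convert! h5

end FeynmanCount

/-! ### Multigraph sums and moments of Hermite polynomials -/

section GraphSum

variable {k : ℕ}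

/-- The weight `∏_{i<j} C(i,j)^{q i j} / (q i j)!` of a multigraph. -/
def graphWeight (C : Fin k → Fin k → ℝ) (q : Fin k → Fin k → ℕ) : ℝ :=
  ∏ p ∈ ltPairs k, C p.1 p.2 ^ q p.1 p.2 / (q p.1 p.2).factorial

/-- The total weight of the multigraphs with degrees `n`. -/
def graphSum (C : Fin k → Fin k → ℝ) (n : Fin k → ℕ) : ℝ := ∑ q ∈ multigraphs n, graphWeight C q

theorem edgeProd_eq_prod_ltPairs (g : Fin k → Fin k → ℝ) {q : Fin k → Fin k → ℕ}
    (h0 : ∀ i, q i i = 0) : edgeProd g q = ∏ p ∈ ltPairs k, g p.1 p.2 ^ q p.1 p.2 := by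
  rw [edgeProd, ← prod_Ioi_eq_prod_ltPairs fun i j => g i j ^ q i j]
  refine Finset.prod_congr rfl fun i _ => ?_
  rw [← Finset.Ioi_insert i, Finset.prod_insert (by simp), h0, pow_zero, one_mul]

theorem feynmanCount_mul_edgeProd (g : Fin k → Fin k → ℝ) {n : Fin k → ℕ} {q : Fin k → Fin k → ℕ}
    (hq : q ∈ multigraphs n) :
    (feynmanCount n q : ℝ) * edgeProd g q = (∏ i, ((n i).factorial : ℝ)) * graphWeight g q := by
  have h := feynmanCount_mul_prod_factorial hq
  rw [prod_Ioi_eq_prod_ltPairs (fun i j => (q i j).factorial)] at h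
  have h' : (feynmanCount n q : ℝ) * ∏ p ∈ ltPairs k, ((q p.1 p.2).factorial : ℝ) =
      ∏ i, ((n i).factorial : ℝ) := by exact_mod_cast h
  have hne : ∏ p ∈ ltPairs k, ((q p.1 p.2).factorial : ℝ) ≠ 0 :=
    Finset.prod_ne_zero_iff.2 fun p _ => by positivity
  rw [edgeProd_eq_prod_ltPairs g (mem_multigraphs.1 hq).2.1, ← h', graphWeight,
    Finset.prod_div_distrib]
  field_simp

/-- Add an edge between `i` and `j`. -/
def addEdge (i j : Fin k) (q : Fin k → Fin k → ℕ) (a b : Fin k) : ℕ :=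
  q a b + if (a = i ∧ b = j) ∨ (a = j ∧ b = i) then 1 else 0

theorem addEdge_comm (i j : Fin k) (q : Fin k → Fin k → ℕ) : addEdge i j q = addEdge j i q := by
  ext a b
  simp only [addEdge, or_comm]

/-- Only the factor of the pair {i, j} changes, and (q+1) c^{q+1}/(q+1)! = c · c^q/q!. -/
theorem graphWeight_addEdge {C : Fin k → Fin k → ℝ} (hC : ∀ i j, C i j = C j i) {i j : Fin k}
    (hij : i ≠ j) {q : Fin k → Fin k → ℕ} (hq : ∀ i j, q i j = q j i) :
    (q i j + 1 : ℝ) * graphWeight C (addEdge i j q) = C i j * graphWeight C q := by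
  wlog h : i < j generalizing i j
  · rw [addEdge_comm, hC, hq]
    exact this hij.symm (lt_of_le_of_ne (not_lt.1 h) hij.symm)
  have hmem : (i, j) ∈ ltPairs k := by simp [ltPairs, h]
  rw [graphWeight, graphWeight, ← Finset.mul_prod_erase _ _ hmem, ← Finset.mul_prod_erase _ _ hmem,
    ← mul_assoc, ← mul_assoc]
  congr 1
  · have h1 : addEdge i j q i j = q i j + 1 := by simp [addEdge]
    rw [h1, Nat.factorial_succ, pow_succ]
    push_cast
    field_simp
  · refine Finset.prod_congr rfl fun p hp => ?_
    have hp' := Finset.mem_erase.1 hp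
    have hlt : p.1 < p.2 := by simpa [ltPairs] using hp'.2
    have h1 : addEdge i j q p.1 p.2 = q p.1 p.2 := by
      simp only [addEdge, Nat.add_eq_left, ite_eq_right_iff, one_ne_zero, imp_false, not_or]
      refine ⟨fun h2 => hp'.1 (Prod.ext h2.1 h2.2), fun h2 => ?_⟩
      rw [h2.1, h2.2] at hlt
      exact lt_asymm h hlt
    rw [h1]

theorem sum_addEdge {i j : Fin k} (hij : i ≠ j) (q : Fin k → Fin k → ℕ) (a : Fin k) :
    ∑ b, addEdge i j q a b = ∑ b, q a b + (Pi.single i 1 + Pi.single j 1 : Fin k → ℕ) a := by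
  simp only [addEdge, Finset.sum_add_distrib, Nat.add_left_cancel_iff, Pi.add_apply]
  by_cases hi : a = i
  · subst hi
    simp [hij]
  · by_cases hj : a = j
    · subst hj
      simp [hij.symm]
    · simp [hi, hj]

theorem addEdge_mem_multigraphs_iff {i j : Fin k} (hij : i ≠ j) (q : Fin k → Fin k → ℕ)
    (m : Fin k → ℕ) : addEdge i j q ∈ multigraphs (m + Pi.single i 1 + Pi.single j 1) ↔
      q ∈ multigraphs m := by
  rw [mem_multigraphs, mem_multigraphs]
  refine and_congr ?_ (and_congr ?_ ?_)
  · refine forall_congr' fun a => forall_congr' fun b => ?_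
    have : ((b = i ∧ a = j) ∨ (b = j ∧ a = i)) ↔ ((a = i ∧ b = j) ∨ (a = j ∧ b = i)) := by tauto
    simp only [addEdge, this]
    exact Nat.add_right_cancel_iff
  · refine forall_congr' fun a => ?_
    have : ¬ ((a = i ∧ a = j) ∨ (a = j ∧ a = i)) := by
      rintro (⟨rfl, h⟩ | ⟨rfl, h⟩)
      exacts [hij h, hij h.symm]
    simp [addEdge, this]
  · refine forall_congr' fun a => ?_
    rw [sum_addEdge hij, add_assoc, Pi.add_apply m]
    exact Nat.add_right_cancel_iff

/-- Graphs without an edge between i and j contribute nothing; the others arise from a unique graph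
by adding such an edge. -/
theorem sum_mul_graphWeight {C : Fin k → Fin k → ℝ} (hC : ∀ i j, C i j = C j i) {i j : Fin k}
    (hij : i ≠ j) (m : Fin k → ℕ) :
    ∑ q ∈ multigraphs (m + Pi.single i 1 + Pi.single j 1), (q i j : ℝ) * graphWeight C q =
      C i j * graphSum C m := by
  rw [graphSum, Finset.mul_sum]
  have h1 : ∀ q ∈ multigraphs m, C i j * graphWeight C q =
      (addEdge i j q i j : ℝ) * graphWeight C (addEdge i j q) := by
    intro q hq
    rw [← graphWeight_addEdge hC hij (mem_multigraphs.1 hq).1]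
    simp [addEdge]
  rw [Finset.sum_congr rfl h1, ← Finset.sum_image (s := multigraphs m) (g := addEdge i j)
    (f := fun q => (q i j : ℝ) * graphWeight C q)]
  · symm
    refine Finset.sum_subset ?_ ?_
    · intro q hq
      obtain ⟨q', hq', rfl⟩ := Finset.mem_image.1 hq
      exact (addEdge_mem_multigraphs_iff hij q' m).2 hq'
    · intro q hq hq'
      have : q i j = 0 := by
        by_contra h0
        apply hq'
        have hs := (mem_multigraphs.1 hq).1
        have hadd : addEdge i j
            (fun a b => q a b - if (a = i ∧ b = j) ∨ (a = j ∧ b = i) then 1 else 0) = q := by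
          ext a b
          simp only [addEdge]
          split_ifs with h
          · have : q a b ≠ 0 := by
              rcases h with ⟨rfl, rfl⟩ | ⟨rfl, rfl⟩
              · exact h0
              · rwa [hs]
            omega
          · simp
        refine Finset.mem_image.2 ⟨_, ?_, hadd⟩
        rw [← addEdge_mem_multigraphs_iff hij, hadd]
        exact hq
      simp [this]
  · intro q _ q' _ h
    ext a b
    have := congrFun (congrFun h a) b
    simpa [addEdge] using this

theorem multigraph_eq_zero {n : Fin k → ℕ} {q : Fin k → Fin k → ℕ} (hq : q ∈ multigraphs n)
    {j : Fin k} (hj : n j = 0) (i : Fin k) : q i j = 0 := by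
  obtain ⟨hs, -, hn⟩ := mem_multigraphs.1 hq
  have := hn j
  rw [hj, Finset.sum_eq_zero_iff] at this
  rw [hs]
  exact this i (Finset.mem_univ i)

theorem graphSum_zero (C : Fin k → Fin k → ℝ) : graphSum C 0 = 1 := by
  have : multigraphs (0 : Fin k → ℕ) = {0} := by
    ext q
    rw [Finset.mem_singleton]
    constructor
    · intro hq
      ext i j
      exact multigraph_eq_zero hq rfl i
    · rintro rfl
      simp [mem_multigraphs]
  simp [graphSum, this, graphWeight]

theorem exists_add_single_add_single {n : Fin k → ℕ} {i j : Fin k} (hij : i ≠ j) (hi : n i ≠ 0)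
    (hj : n j ≠ 0) : ∃ m : Fin k → ℕ, n = m + Pi.single i 1 + Pi.single j 1 := by
  refine ⟨n - (Pi.single i 1 + Pi.single j 1), ?_⟩
  rw [add_assoc]
  refine (tsub_add_cancel_of_le fun a => ?_).symm
  by_cases h1 : a = i
  · subst h1
    simp [hij]
    omega
  · by_cases h2 : a = j
    · subst h2
      simp [hij.symm]
      omega
    · simp [h1, h2]

open MvPolynomial in
theorem pderiv_prod_hermiteX_eq_zero (v : Fin k → ℝ) (n : Fin k → ℕ) {s : Finset (Fin k)}
    {j : Fin k} (hj : j ∉ s) : pderiv j (∏ l ∈ s, hermiteX (v l) l (n l)) = 0 := by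
  classical
  induction s using Finset.induction_on with
  | empty => simp
  | insert a s ha ih =>
    rw [Finset.mem_insert, not_or] at hj
    rw [Finset.prod_insert ha, Derivation.leibniz, ih hj.2, pderiv_hermiteX_of_ne _ hj.1]
    simp

theorem prod_eq_mul_mul_prod_erase_erase {ι M : Type*} [Fintype ι] [DecidableEq ι] [CommMonoid M]
    {i j : ι} (hij : i ≠ j) (f : ι → M) :
    ∏ l, f l = f i * (f j * ∏ l ∈ (Finset.univ.erase i).erase j, f l) := by
  rw [Finset.mul_prod_erase _ _ (by simp [hij.symm]), Finset.mul_prod_erase _ _ (Finset.mem_univ i)]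

open MvPolynomial in
/-- The expectation of a product of Hermite polynomials of a Gaussian vector. -/
theorem IsSteinFunctional.prod_hermiteX {C : Fin k → Fin k → ℝ} (hC : ∀ i j, C i j = C j i)
    {E : MvPolynomial (Fin k) ℝ →ₗ[ℝ] ℝ} (hE : IsSteinFunctional C E) (h1 : E 1 = 1)
    (n : Fin k → ℕ) :
    E (∏ l, hermiteX (C l l) l (n l)) = (∏ l, ((n l).factorial : ℝ)) * graphSum C n := by
  classical
  induction hN : ∑ l, n l using Nat.strong_induction_on generalizing n with
  | _ N ih =>
  by_cases h0 : n = 0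
  · subst h0
    simp [hermiteX_zero, h1, graphSum_zero]
  obtain ⟨i, hi⟩ : ∃ i, n i ≠ 0 := by
    by_contra! h
    exact h0 (funext h)
  obtain ⟨r, hr⟩ := Nat.exists_eq_succ_of_ne_zero hi
  have hr' : (n i : ℝ) ≠ 0 := by exact_mod_cast hi
  have hL : E (∏ l, hermiteX (C l l) l (n l)) = ∑ j, C i j * E (hermiteX (C i i) i r *
      pderiv j (∏ l ∈ Finset.univ.erase i, hermiteX (C l l) l (n l))) := by
    rw [← Finset.mul_prod_erase _ _ (Finset.mem_univ i), hr, Nat.succ_eq_add_one,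
      hE.hermiteX_mul]
  -- Since n_i = ∑_j q_ij, this sums over the other end j of a marked edge at i, matching the sum
  -- over j from integration by parts. The two sums are then compared term by term.
  have hR : (n i : ℝ) * graphSum C n = ∑ j, ∑ q ∈ multigraphs n, (q i j : ℝ) * graphWeight C q := by
    rw [graphSum, Finset.mul_sum, Finset.sum_comm]
    refine Finset.sum_congr rfl fun q hq => ?_
    rw [← Finset.sum_mul, ← (mem_multigraphs.1 hq).2.2 i]
    push_cast
    rfl
  have hR' : (∏ l, ((n l).factorial : ℝ)) * graphSum C n =
      ∑ j, ((∏ l, ((n l).factorial : ℝ)) / n i) *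
        ∑ q ∈ multigraphs n, (q i j : ℝ) * graphWeight C q := by
    rw [← Finset.mul_sum, ← hR]
    field_simp
  rw [hL, hR']
  refine Finset.sum_congr rfl fun j _ => ?_
  by_cases hij : j = i
  · subst hij
    rw [pderiv_prod_hermiteX_eq_zero _ _ (by simp)]
    have : ∀ q ∈ multigraphs n, (q j j : ℝ) * graphWeight C q = 0 := by
      intro q hq
      simp [(mem_multigraphs.1 hq).2.1]
    rw [Finset.sum_eq_zero this]
    simp
  have hje : j ∈ Finset.univ.erase i := by simp [hij]
  have hder : pderiv j (∏ l ∈ Finset.univ.erase i, hermiteX (C l l) l (n l)) =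
      (n j : ℝ) • (hermiteX (C j j) j (n j - 1) *
        ∏ l ∈ (Finset.univ.erase i).erase j, hermiteX (C l l) l (n l)) := by
    rw [← Finset.mul_prod_erase _ _ hje, Derivation.leibniz,
      pderiv_prod_hermiteX_eq_zero _ _ (by simp), pderiv_hermiteX_self, smul_zero, zero_add,
      smul_eq_mul, mul_smul_comm, mul_comm]
  rw [hder]
  by_cases hj : n j = 0
  · have : ∀ q ∈ multigraphs n, (q i j : ℝ) * graphWeight C q = 0 := by
      intro q hq
      simp [multigraph_eq_zero hq hj]
    rw [Finset.sum_eq_zero this, hj]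
    simp
  -- Contracting one half-edge at i with one at j leaves the degrees m, of smaller total.
  obtain ⟨m, hm⟩ := exists_add_single_add_single (Ne.symm hij) hi hj
  have hsame : ∀ l ∈ (Finset.univ.erase i).erase j, n l = m l := by
    intro l hl
    simp only [Finset.mem_erase, Finset.mem_univ, and_true] at hl
    simp [hm, hl.1, hl.2]
  have hmi : n i = m i + 1 := by
    simp [hm, Ne.symm hij]
  have hmj : n j = m j + 1 := by
    simp [hm, hij]
  have hrm : r = m i := by omega
  have hsum : ∑ q ∈ multigraphs n, (q i j : ℝ) * graphWeight C q = C i j * graphSum C m := by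
    rw [hm, sum_mul_graphWeight hC (Ne.symm hij)]
  have hfac := prod_eq_mul_mul_prod_erase_erase (Ne.symm hij) fun l => ((n l).factorial : ℝ)
  have hprod : ∏ l ∈ (Finset.univ.erase i).erase j, hermiteX (C l l) l (n l) =
      ∏ l ∈ (Finset.univ.erase i).erase j, hermiteX (C l l) l (m l) :=
    Finset.prod_congr rfl fun l hl => by rw [hsame l hl]
  have hprod' : ∏ l ∈ (Finset.univ.erase i).erase j, ((n l).factorial : ℝ) =
      ∏ l ∈ (Finset.univ.erase i).erase j, ((m l).factorial : ℝ) :=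
    Finset.prod_congr rfl fun l hl => by rw [hsame l hl]
  rw [hsum, hfac, hprod, hprod', hmi, hmj, hrm, Nat.add_sub_cancel,
    mul_smul_comm, map_smul, smul_eq_mul]
  have hih := ih (∑ l, m l) (by
    rw [← hN, hm]
    simp only [Pi.add_apply, Finset.sum_add_distrib]
    simp) m rfl
  rw [prod_eq_mul_mul_prod_erase_erase (Ne.symm hij),
    prod_eq_mul_mul_prod_erase_erase (Ne.symm hij) fun l => ((m l).factorial : ℝ)] at hih
  rw [hih, Nat.factorial_succ, Nat.factorial_succ]
  push_cast
  field_simp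

end GraphSum

/-! ### Cumulants and their recursion -/

section Partition

variable {ι : Type*} [DecidableEq ι]

/-- The coefficient `(m - 1)! (-1)^(m - 1)`. -/
def cumulantCoeff (m : ℕ) : ℝ := ((m - 1).factorial : ℝ) * (-1) ^ (m - 1)

/-- The cumulants of a family of moments. -/
def setCumulant (M : Finset ι → ℝ) (S : Finset ι) : ℝ :=
  ∑ π : Finpartition S, cumulantCoeff π.parts.card * ∏ B ∈ π.parts, M B

/-- For m ≥ 2, (m-1)! = (m-1)(m-2)! and the signs are opposite. This cancellation inverts the
moment–cumulant relation. -/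
theorem cumulantCoeff_add {m : ℕ} (hm : 1 ≤ m) :
    cumulantCoeff m + ((m : ℝ) - 1) * cumulantCoeff (m - 1) = if m = 1 then 1 else 0 := by
  obtain ⟨r, rfl⟩ := Nat.exists_eq_add_of_le hm
  rcases r with _ | r
  · simp [cumulantCoeff]
  · have h1 : 1 + (r + 1) - 1 = r + 1 := by omega
    have h2 : 1 + (r + 1) ≠ 1 := by omega
    rw [h1, if_neg h2, cumulantCoeff, cumulantCoeff, h1, Nat.add_sub_cancel, Nat.factorial_succ,
      pow_succ]
    push_cast
    ring

/-- Remove a part from a partition. -/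
def eraseParts {S : Finset ι} (σ : Finpartition S) {D : Finset ι} (hD : D ∈ σ.parts) :
    Finpartition (S \ D) where
  parts := σ.parts.erase D
  supIndep := σ.supIndep.subset (Finset.erase_subset _ _)
  sup_parts := by
    ext a
    simp only [Finset.mem_sup, Finset.mem_erase, id_eq, Finset.mem_sdiff]
    constructor
    · rintro ⟨B, ⟨hne, hB⟩, ha⟩
      exact ⟨σ.subset hB ha, fun haD => hne (σ.eq_of_mem_parts hB hD ha haD)⟩
    · rintro ⟨haS, haD⟩
      obtain ⟨B, hB, ha⟩ := σ.exists_mem haS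
      exact ⟨B, ⟨fun h => haD (h ▸ ha), hB⟩, ha⟩
  bot_notMem h := σ.bot_notMem (Finset.mem_of_mem_erase h)

theorem finpartition_sigma_ext {x y : Σ B : Finset ι, Finpartition B} (h1 : x.1 = y.1)
    (h2 : x.2.parts = y.2.parts) : x = y := by
  obtain ⟨B, π⟩ := x
  obtain ⟨B', π'⟩ := y
  obtain rfl : B = B' := h1
  obtain rfl : π = π' := Finpartition.ext h2
  rfl

/-- Adding a block to the partitions of the proper subsets that contain a given point. -/
theorem sum_proper_subsets_partition {S : Finset ι} {s : ι} (hs : s ∈ S)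
    (F : Finset (Finset ι) → ℝ) (M : Finset ι → ℝ) :
    ∑ B ∈ S.powerset.filter (fun B => s ∈ B ∧ B ≠ S), ∑ π : Finpartition B,
        F π.parts * M (S \ B) =
      ∑ σ : Finpartition S, ∑ D ∈ σ.parts.filter fun D => s ∉ D, F (σ.parts.erase D) * M D := by
  rw [Finset.sum_sigma', Finset.sum_sigma']
  have hsub : ∀ x ∈ (S.powerset.filter fun B => s ∈ B ∧ B ≠ S).sigma
      fun B => (Finset.univ : Finset (Finpartition B)), x.1 ⊆ S ∧ s ∈ x.1 ∧ S \ x.1 ≠ ∅ := by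
    intro x hx
    simp only [Finset.mem_sigma, Finset.mem_filter, Finset.mem_powerset, Finset.mem_univ,
      and_true] at hx
    refine ⟨hx.1, hx.2.1, fun h => hx.2.2 (hx.1.antisymm (Finset.sdiff_eq_empty_iff_subset.1 h))⟩
  have hnot : ∀ x ∈ (S.powerset.filter fun B => s ∈ B ∧ B ≠ S).sigma
      fun B => (Finset.univ : Finset (Finpartition B)), S \ x.1 ∉ x.2.parts := by
    intro x hx h
    obtain ⟨a, ha⟩ := Finset.nonempty_iff_ne_empty.2 (hsub x hx).2.2
    exact (Finset.mem_sdiff.1 ha).2 (x.2.subset h ha)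
  refine Finset.sum_bij'
    (fun x hx => ⟨x.2.extend (hsub x hx).2.2 disjoint_sdiff_self_right
      (sup_sdiff_cancel_right (hsub x hx).1), S \ x.1⟩)
    (fun y hy => ⟨S \ y.2, eraseParts y.1 (Finset.mem_filter.1 (Finset.mem_sigma.1 hy).2).1⟩)
    ?_ ?_ ?_ ?_ ?_
  · intro x hx
    simp only [Finset.mem_sigma, Finset.mem_univ, true_and, Finset.mem_filter,
      Finpartition.extend_parts, Finset.mem_insert, true_or, Finset.mem_sdiff, not_and, not_not]
    exact fun _ => (hsub x hx).2.1
  · intro y hy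
    obtain ⟨-, hy2⟩ := Finset.mem_sigma.1 hy
    obtain ⟨hD, hsD⟩ := Finset.mem_filter.1 hy2
    simp only [Finset.mem_sigma, Finset.mem_univ, and_true, Finset.mem_filter, Finset.mem_powerset,
      Finset.sdiff_subset, true_and, Finset.mem_sdiff, hs, hsD, not_false_eq_true, ne_eq,
      sdiff_eq_left]
    intro hdis
    obtain ⟨a, ha⟩ := y.1.nonempty_of_mem_parts hD
    exact Finset.disjoint_left.1 hdis (y.1.subset hD ha) ha
  · intro x hx
    refine finpartition_sigma_ext (Finset.sdiff_sdiff_eq_self (hsub x hx).1) ?_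
    simp only [eraseParts, Finpartition.extend_parts]
    exact Finset.erase_insert (hnot x hx)
  · intro y hy
    obtain ⟨σ, D⟩ := y
    obtain ⟨-, hy2⟩ := Finset.mem_sigma.1 hy
    obtain ⟨hD, hsD⟩ := Finset.mem_filter.1 hy2
    have hDS : S \ (S \ D) = D := Finset.sdiff_sdiff_eq_self (σ.subset hD)
    refine Sigma.ext (Finpartition.ext ?_) (heq_of_eq hDS)
    simp only [eraseParts, Finpartition.extend_parts, hDS]
    exact Finset.insert_erase hD
  · intro x hx
    simp only [Finpartition.extend_parts]
    rw [Finset.erase_insert (hnot x hx)]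

/-- For B ≠ S, a partition of B together with the block S \ B is a partition of S with a marked
block avoiding s. A partition with m blocks has m - 1 such blocks, so its coefficients cancel unless
m = 1. -/
theorem moment_eq_sum_setCumulant {M : Finset ι → ℝ} (hM : M ∅ = 1) {S : Finset ι} {s : ι}
    (hs : s ∈ S) :
    M S = ∑ B ∈ S.powerset.filter (fun B => s ∈ B), setCumulant M B * M (S \ B) := by
  have hsplit : S.powerset.filter (fun B => s ∈ B) =
      insert S (S.powerset.filter fun B => s ∈ B ∧ B ≠ S) := by
    ext B
    simp only [Finset.mem_filter, Finset.mem_powerset, Finset.mem_insert]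
    by_cases h : B = S
    · simp [h, hs]
    · simp [h]
  rw [hsplit, Finset.sum_insert (by simp), Finset.sdiff_self, hM, mul_one]
  have h1 : ∑ B ∈ S.powerset.filter (fun B => s ∈ B ∧ B ≠ S), setCumulant M B * M (S \ B) =
      ∑ σ : Finpartition S, ((σ.parts.card : ℝ) - 1) * cumulantCoeff (σ.parts.card - 1) *
        ∏ B ∈ σ.parts, M B := by
    simp_rw [setCumulant, Finset.sum_mul]
    rw [sum_proper_subsets_partition hs (fun p => cumulantCoeff p.card * ∏ B ∈ p, M B)]
    refine Finset.sum_congr rfl fun σ _ => ?_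
    have h2 : ∀ D ∈ σ.parts.filter fun D => s ∉ D,
        (cumulantCoeff (σ.parts.erase D).card * ∏ B ∈ σ.parts.erase D, M B) * M D =
          cumulantCoeff (σ.parts.card - 1) * ∏ B ∈ σ.parts, M B := by
      intro D hD
      have hD' := (Finset.mem_filter.1 hD).1
      rw [Finset.card_erase_of_mem hD', mul_assoc, Finset.prod_erase_mul _ _ hD']
    have h3 : σ.parts.filter (fun D => s ∉ D) = σ.parts.erase (σ.part s) := by
      ext D
      rw [Finset.mem_filter, Finset.mem_erase, and_comm]
      refine and_congr_left fun hD => ?_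
      rw [not_iff_comm, not_not, eq_comm, σ.part_eq_iff_mem hD]
    rw [Finset.sum_congr rfl h2, Finset.sum_const, h3,
      Finset.card_erase_of_mem (σ.part_mem.2 hs), nsmul_eq_mul, mul_assoc]
    congr 1
    have : 1 ≤ σ.parts.card := Finset.card_pos.2 ⟨_, σ.part_mem.2 hs⟩
    push_cast [this]
    ring
  rw [h1, setCumulant, ← Finset.sum_add_distrib]
  have h4 : ∀ σ : Finpartition S, cumulantCoeff σ.parts.card * ∏ B ∈ σ.parts, M B +
      ((σ.parts.card : ℝ) - 1) * cumulantCoeff (σ.parts.card - 1) * ∏ B ∈ σ.parts, M B =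
        if σ = Finpartition.indiscrete (Finset.nonempty_iff_ne_empty.1 ⟨s, hs⟩) then M S else 0 := by
    intro σ
    rw [← add_mul, cumulantCoeff_add (Finset.card_pos.2 ⟨_, σ.part_mem.2 hs⟩)]
    by_cases h : σ.parts.card = 1
    · obtain ⟨B, hB⟩ := Finset.card_eq_one.1 h
      have hBS : B = S := by
        have := σ.sup_parts
        rw [hB] at this
        simpa using this
      have : σ = Finpartition.indiscrete (Finset.nonempty_iff_ne_empty.1 ⟨s, hs⟩) :=
        Finpartition.ext (by rw [hB, hBS]; rfl)
      rw [if_pos h, if_pos this, hB, hBS]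
      simp
    · have : σ ≠ Finpartition.indiscrete (Finset.nonempty_iff_ne_empty.1 ⟨s, hs⟩) := by
        rintro rfl
        exact h (Finset.card_singleton S)
      rw [if_neg h, if_neg this, zero_mul]
  rw [Finset.sum_congr rfl fun σ _ => h4 σ]
  simp

/-- Cumulants are determined by the recursion that peels off the block of a point. -/
theorem setCumulant_eq_of_recursion {M C : Finset ι → ℝ} (hM : M ∅ = 1)
    (hC : ∀ S : Finset ι, ∀ s ∈ S,
      M S = ∑ B ∈ S.powerset.filter (fun B => s ∈ B), C B * M (S \ B))
    {S : Finset ι} (hS : S.Nonempty) : setCumulant M S = C S := by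
  induction S using Finset.strongInduction with
  | H S ih =>
    obtain ⟨s, hs⟩ := hS
    have h1 := moment_eq_sum_setCumulant hM hs
    rw [hC S s hs] at h1
    -- Because `M ∅ = 1`, the term B = S is the unknown itself; the other terms agree by induction.
    have hmem : S ∈ S.powerset.filter (fun B => s ∈ B) := by simp [hs]
    rw [← Finset.add_sum_erase _ _ hmem, ← Finset.add_sum_erase _ _ hmem, Finset.sdiff_self, hM,
      mul_one, mul_one] at h1
    have h2 : ∑ B ∈ (S.powerset.filter (fun B => s ∈ B)).erase S, C B * M (S \ B) =
        ∑ B ∈ (S.powerset.filter (fun B => s ∈ B)).erase S, setCumulant M B * M (S \ B) := by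
      refine Finset.sum_congr rfl fun B hB => ?_
      obtain ⟨hne, hB⟩ := Finset.mem_erase.1 hB
      obtain ⟨hsub, hsB⟩ := Finset.mem_filter.1 hB
      rw [ih B ((Finset.mem_powerset.1 hsub).ssubset_of_ne hne) ⟨s, hsB⟩]
    rw [h2] at h1
    exact (add_right_cancel h1).symm

end Partition

/-! ### Decomposition into connected components -/

section Components

variable {k : ℕ}

/-- Restrict the degrees to a set of vertices. -/
def degreesOn (n : Fin k → ℕ) (S : Finset (Fin k)) (l : Fin k) : ℕ := if l ∈ S then n l else 0

/-- `b` can be reached from `a` along the edges of `q`. -/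
def GraphReach (q : Fin k → Fin k → ℕ) : Fin k → Fin k → Prop :=
  Relation.ReflTransGen fun a b => q a b ≠ 0

open Classical in
/-- The multigraphs on the vertices in `S` that are connected. -/
def connectedOn (n : Fin k → ℕ) (S : Finset (Fin k)) : Finset (Fin k → Fin k → ℕ) :=
  (multigraphs (degreesOn n S)).filter fun q => ∀ a ∈ S, ∀ b ∈ S, GraphReach q a b

theorem mem_connectedOn {n : Fin k → ℕ} {S : Finset (Fin k)} {q : Fin k → Fin k → ℕ} :
    q ∈ connectedOn n S ↔
      q ∈ multigraphs (degreesOn n S) ∧ ∀ a ∈ S, ∀ b ∈ S, GraphReach q a b := by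
  classical
  rw [connectedOn, Finset.mem_filter]

theorem GraphReach.symm {q : Fin k → Fin k → ℕ} (hq : ∀ i j, q i j = q j i) {a b : Fin k}
    (h : GraphReach q a b) : GraphReach q b a := by
  induction h with
  | refl => exact Relation.ReflTransGen.refl
  | tail _ hcd ih => exact Relation.ReflTransGen.head (by rwa [hq]) ih

theorem GraphReach.mono {q q' : Fin k → Fin k → ℕ} (hq : ∀ i j, q i j ≠ 0 → q' i j ≠ 0)
    {a b : Fin k} (h : GraphReach q a b) : GraphReach q' a b := by
  induction h with
  | refl => exact Relation.ReflTransGen.refl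
  | tail _ hcd ih => exact ih.tail (hq _ _ hcd)

theorem GraphReach.mem_of_closed {q : Fin k → Fin k → ℕ} {B : Finset (Fin k)}
    (hB : ∀ a ∈ B, ∀ b, q a b ≠ 0 → b ∈ B) {a b : Fin k} (ha : a ∈ B) (h : GraphReach q a b) :
    b ∈ B := by
  induction h with
  | refl => exact ha
  | tail _ hcd ih => exact hB _ ih _ hcd

theorem GraphReach.restrict {q q' : Fin k → Fin k → ℕ} {B : Finset (Fin k)}
    (hB : ∀ a ∈ B, ∀ b, q a b ≠ 0 → b ∈ B)
    (hq' : ∀ a ∈ B, ∀ b ∈ B, q' a b = q a b) {a b : Fin k} (ha : a ∈ B) (h : GraphReach q a b) :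
    GraphReach q' a b := by
  induction h with
  | refl => exact Relation.ReflTransGen.refl
  | tail hac hcd ih =>
    have hc := GraphReach.mem_of_closed hB ha hac
    exact ih.tail (by rwa [hq' _ hc _ (hB _ hc _ hcd)])

theorem multigraphConnected_iff {n : Fin k → ℕ} {q : Fin k → Fin k → ℕ} (hq : q ∈ multigraphs n) :
    MultigraphConnected q ↔ ∀ a b, GraphReach q a b := by
  obtain ⟨hs, h0, -⟩ := mem_multigraphs.1 hq
  have hadj : (SimpleGraph.fromRel fun i j => q i j ≠ 0).Adj = fun a b => q a b ≠ 0 := by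
    ext a b
    rw [SimpleGraph.fromRel_adj, hs b a, or_self, and_iff_right_iff_imp]
    rintro h rfl
    exact h (h0 a)
  unfold MultigraphConnected SimpleGraph.Preconnected GraphReach
  simp_rw [SimpleGraph.reachable_iff_reflTransGen, hadj]

theorem connectedMultigraphs_eq (n : Fin k → ℕ) :
    connectedMultigraphs n = connectedOn n Finset.univ := by
  ext q
  have : degreesOn n Finset.univ = n := by ext; simp [degreesOn]
  classical
  rw [mem_connectedOn, connectedMultigraphs, this, Finset.mem_filter]
  refine and_congr_right fun hq => ?_
  simp [multigraphConnected_iff hq]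

theorem graphWeight_add (C : Fin k → Fin k → ℝ) {q q' : Fin k → Fin k → ℕ}
    (h : ∀ i j, q i j = 0 ∨ q' i j = 0) :
    graphWeight C (q + q') = graphWeight C q * graphWeight C q' := by
  rw [graphWeight, graphWeight, graphWeight, ← Finset.prod_mul_distrib]
  refine Finset.prod_congr rfl fun p _ => ?_
  rcases h p.1 p.2 with h | h <;> simp [h]

theorem multigraph_eq_zero_left {n : Fin k → ℕ} {q : Fin k → Fin k → ℕ} (hq : q ∈ multigraphs n)
    {i : Fin k} (hi : n i = 0) (j : Fin k) : q i j = 0 := by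
  rw [(mem_multigraphs.1 hq).1]
  exact multigraph_eq_zero hq hi j

theorem degreesOn_of_notMem (n : Fin k → ℕ) {S : Finset (Fin k)} {l : Fin k} (h : l ∉ S) :
    degreesOn n S l = 0 := if_neg h

/-- Restrict a multigraph to a set of vertices. -/
def restrictGraph (B : Finset (Fin k)) (q : Fin k → Fin k → ℕ) (a b : Fin k) : ℕ :=
  if a ∈ B ∧ b ∈ B then q a b else 0

theorem restrictGraph_mem {n m : Fin k → ℕ} {q : Fin k → Fin k → ℕ} (hq : q ∈ multigraphs n)
    {B : Finset (Fin k)} (hB : ∀ a ∈ B, ∀ b, q a b ≠ 0 → b ∈ B)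
    (hm : ∀ a, m a = if a ∈ B then n a else 0) : restrictGraph B q ∈ multigraphs m := by
  obtain ⟨hs, h0, hn⟩ := mem_multigraphs.1 hq
  refine mem_multigraphs.2 ⟨fun a b => ?_, fun a => ?_, fun a => ?_⟩
  · simp only [restrictGraph, and_comm, hs a b]
  · simp [restrictGraph, h0]
  · rw [hm]
    split_ifs with ha
    · rw [← hn]
      refine Finset.sum_congr rfl fun b _ => ?_
      simp only [restrictGraph, ha, true_and, ite_eq_left_iff]
      intro hb
      by_contra h
      exact hb (hB a ha b (Ne.symm h))
    · simp [restrictGraph, ha]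

/-- When B is the component of s, no edge leaves B, so the graph is uniquely a connected graph on B
plus an arbitrary one on S \ B. The weight factorises because every pair carries edges of at most
one of them. -/
theorem sum_component_eq (C : Fin k → Fin k → ℝ) (n : Fin k → ℕ) {S B : Finset (Fin k)}
    (hBS : B ⊆ S) {s : Fin k} (hs : s ∈ B) (p : (Fin k → Fin k → ℕ) → Prop) [DecidablePred p]
    (hp : ∀ q, p q ↔ ∀ b, b ∈ B ↔ b ∈ S ∧ GraphReach q s b) :
    ∑ q ∈ (multigraphs (degreesOn n S)).filter p, graphWeight C q =
      (∑ q ∈ connectedOn n B, graphWeight C q) * graphSum C (degreesOn n (S \ B)) := by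
  rw [graphSum, Finset.sum_mul_sum, ← Finset.sum_product']
  have hz : ∀ {q T}, q ∈ multigraphs (degreesOn n T) → ∀ a b, q a b ≠ 0 → a ∈ T ∧ b ∈ T := by
    intro q T hq a b hab
    constructor <;> by_contra h
    · exact hab (multigraph_eq_zero_left hq (degreesOn_of_notMem n h) b)
    · exact hab (multigraph_eq_zero hq (degreesOn_of_notMem n h) a)
  have hclosed : ∀ q ∈ (multigraphs (degreesOn n S)).filter p, ∀ a ∈ B, ∀ b, q a b ≠ 0 → b ∈ B := by
    intro q hq a ha b hab
    obtain ⟨hq1, hq2⟩ := Finset.mem_filter.1 hq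
    rw [hp] at hq2
    exact (hq2 b).2 ⟨(hz hq1 a b hab).2, ((hq2 a).1 ha).2.tail hab⟩
  have hclosed' : ∀ q ∈ (multigraphs (degreesOn n S)).filter p,
      ∀ a ∈ Bᶜ, ∀ b, q a b ≠ 0 → b ∈ Bᶜ := by
    intro q hq a ha b hab
    rw [Finset.mem_compl] at ha ⊢
    intro hb
    refine ha (hclosed q hq b hb a ?_)
    rwa [(mem_multigraphs.1 (Finset.mem_filter.1 hq).1).1]
  have hdisj : ∀ x ∈ connectedOn n B ×ˢ multigraphs (degreesOn n (S \ B)),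
      ∀ a b, x.1 a b = 0 ∨ x.2 a b = 0 := by
    intro x hx a b
    obtain ⟨hx1, hx2⟩ := Finset.mem_product.1 hx
    by_contra! h
    exact (Finset.mem_sdiff.1 (hz hx2 a b h.2).1).2 (hz (mem_connectedOn.1 hx1).1 a b h.1).1
  symm
  -- Restricting to Bᶜ serves as well as restricting to S \ B, since the degrees vanish outside S.
  refine Finset.sum_bij' (fun x _ => x.1 + x.2)
    (fun q _ => (restrictGraph B q, restrictGraph Bᶜ q)) ?_ ?_ ?_ ?_ ?_
  · intro x hx
    obtain ⟨hx1, hx2⟩ := Finset.mem_product.1 hx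
    obtain ⟨hx1, hconn⟩ := mem_connectedOn.1 hx1
    obtain ⟨hs1, h01, hn1⟩ := mem_multigraphs.1 hx1
    obtain ⟨hs2, h02, hn2⟩ := mem_multigraphs.1 hx2
    refine Finset.mem_filter.2 ⟨mem_multigraphs.2 ⟨fun a b => ?_, fun a => ?_, fun a => ?_⟩, ?_⟩
    · simp [hs1 a b, hs2 a b]
    · simp [h01, h02]
    · simp only [Pi.add_apply, Finset.sum_add_distrib, hn1, hn2, degreesOn, Finset.mem_sdiff]
      by_cases h1 : a ∈ B
      · simp [h1, hBS h1]
      · simp [h1]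
    · rw [hp]
      intro b
      constructor
      · intro hb
        refine ⟨hBS hb, ?_⟩
        exact GraphReach.mono (fun c d hcd => by
          simp only [Pi.add_apply]
          omega) (hconn s hs b hb)
      · rintro ⟨-, hb⟩
        refine GraphReach.mem_of_closed ?_ hs hb
        intro a ha c hac
        have h2 : x.2 a c = 0 := multigraph_eq_zero_left hx2
          (degreesOn_of_notMem n fun h => (Finset.mem_sdiff.1 h).2 ha) c
        refine (hz hx1 a c ?_).2
        simpa [h2] using hac
  · intro q hq
    obtain ⟨hq1, hq2⟩ := Finset.mem_filter.1 hq
    rw [hp] at hq2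
    refine Finset.mem_product.2 ⟨mem_connectedOn.2 ⟨restrictGraph_mem hq1 (hclosed q hq) ?_, ?_⟩,
      restrictGraph_mem hq1 (hclosed' q hq) ?_⟩
    · intro a
      by_cases h : a ∈ B
      · simp [degreesOn, h, hBS h]
      · simp [degreesOn, h]
    · intro a ha b hb
      refine GraphReach.restrict (hclosed q hq) (fun c hc d hd => by simp [restrictGraph, hc, hd])
        ha ?_
      exact (((hq2 a).1 ha).2.symm (mem_multigraphs.1 hq1).1).trans ((hq2 b).1 hb).2
    · intro a
      by_cases h : a ∈ B
      · simp [degreesOn, h]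
      · simp [degreesOn, h]
  · intro x hx
    obtain ⟨hx1, hx2⟩ := Finset.mem_product.1 hx
    obtain ⟨hx1, -⟩ := mem_connectedOn.1 hx1
    refine Prod.ext ?_ ?_
    · ext a b
      simp only [restrictGraph, Pi.add_apply]
      split_ifs with h
      · rw [multigraph_eq_zero_left hx2
          (degreesOn_of_notMem n fun h' => (Finset.mem_sdiff.1 h').2 h.1) b, add_zero]
      · by_contra h'
        exact h (hz hx1 a b (Ne.symm h'))
    · ext a b
      simp only [restrictGraph, Pi.add_apply, Finset.mem_compl]
      split_ifs with h
      · rw [multigraph_eq_zero_left hx1 (degreesOn_of_notMem n h.1) b, zero_add]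
      · by_contra h'
        have := hz hx2 a b (Ne.symm h')
        exact h ⟨(Finset.mem_sdiff.1 this.1).2, (Finset.mem_sdiff.1 this.2).2⟩
  · intro q hq
    ext a b
    simp only [restrictGraph, Pi.add_apply, Finset.mem_compl]
    by_cases ha : a ∈ B
    · by_cases hb : b ∈ B
      · simp [ha, hb]
      · have : q a b = 0 := by
          by_contra h
          exact hb (hclosed q hq a ha b h)
        simp [ha, hb, this]
    · by_cases hb : b ∈ B
      · have : q a b = 0 := by
          by_contra h
          exact Finset.mem_compl.1 (hclosed' q hq a (Finset.mem_compl.2 ha) b h) hb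
        simp [ha, hb, this]
      · simp [ha, hb]
  · intro x hx
    exact (graphWeight_add C (hdisj x hx)).symm

/-- Decomposition of a multigraph into the component of `s` and the rest. -/
theorem graphSum_eq_sum_connected (C : Fin k → Fin k → ℝ) (n : Fin k → ℕ) {S : Finset (Fin k)}
    {s : Fin k} (hs : s ∈ S) :
    graphSum C (degreesOn n S) = ∑ B ∈ S.powerset.filter (fun B => s ∈ B),
      (∑ q ∈ connectedOn n B, graphWeight C q) * graphSum C (degreesOn n (S \ B)) := by
  classical
  rw [graphSum, ← Finset.sum_fiberwise_of_maps_to (g := fun q => S.filter fun b => GraphReach q s b)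
    (t := S.powerset.filter (fun B => s ∈ B))]
  · refine Finset.sum_congr rfl fun B hB => ?_
    obtain ⟨h1, h2⟩ := Finset.mem_filter.1 hB
    refine sum_component_eq C n (Finset.mem_powerset.1 h1) h2 _ fun q => ?_
    rw [eq_comm, Finset.ext_iff]
    simp only [Finset.mem_filter]
  · intro q _
    simp only [Finset.mem_filter, Finset.mem_powerset, Finset.filter_subset, true_and]
    exact ⟨hs, Relation.ReflTransGen.refl⟩

/-- The component decomposition is the cumulant recursion: the factorials split over B and S \ B,
and the recursion has only one solution. -/
theorem setCumulant_graphSum (C : Fin k → Fin k → ℝ) (n : Fin k → ℕ) {S : Finset (Fin k)}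
    (hS : S.Nonempty) :
    setCumulant (fun B => (∏ i ∈ B, ((n i).factorial : ℝ)) * graphSum C (degreesOn n B)) S =
      (∏ i ∈ S, ((n i).factorial : ℝ)) * ∑ q ∈ connectedOn n S, graphWeight C q := by
  refine setCumulant_eq_of_recursion
    (C := fun S => (∏ i ∈ S, ((n i).factorial : ℝ)) * ∑ q ∈ connectedOn n S, graphWeight C q)
    ?_ ?_ hS
  · have : degreesOn n ∅ = 0 := by ext; simp [degreesOn]
    simp [this, graphSum_zero]
  · intro S s hs
    rw [graphSum_eq_sum_connected C n hs, Finset.mul_sum]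
    refine Finset.sum_congr rfl fun B hB => ?_
    have hBS := Finset.mem_powerset.1 (Finset.mem_filter.1 hB).1
    rw [← Finset.prod_sdiff hBS]
    ring

end Components

/-! ### Hölder's inequality for finite products -/

section Hoelder

variable {Ω : Type*} [MeasurableSpace Ω] {P : Measure Ω} [IsProbabilityMeasure P]

-- Writing exponents as inverses of sums of reciprocals makes Hölder additive, so it iterates over a
-- finite set; the empty sum gives the exponent ∞.
omit [IsProbabilityMeasure P] in
theorem eLpNorm_mul_le_of_inv_add {f g : Ω → ℝ} (hf : AEStronglyMeasurable f P)
    (hg : AEStronglyMeasurable g P) (p : ℝ≥0∞) (c : ℝ≥0∞) :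
    eLpNorm (fun ω => f ω * g ω) (p⁻¹ + c)⁻¹ P ≤ eLpNorm f p P * eLpNorm g c⁻¹ P := by
  have : ENNReal.HolderTriple p c⁻¹ (p⁻¹ + c)⁻¹ := ⟨by simp⟩
  have h := eLpNorm_le_eLpNorm_mul_eLpNorm'_of_norm (p := p) (q := c⁻¹) (r := (p⁻¹ + c)⁻¹) hf hg
    (fun u v : ℝ => u * v) 1 (Eventually.of_forall fun ω => by simp [norm_mul])
  simpa using h

omit [IsProbabilityMeasure P] in
theorem aestronglyMeasurable_prod {ι : Type*} (s : Finset ι) {f : ι → Ω → ℝ}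
    (hf : ∀ i ∈ s, AEStronglyMeasurable (f i) P) :
    AEStronglyMeasurable (fun ω => ∏ i ∈ s, f i ω) P :=
  Finset.aestronglyMeasurable_fun_prod s hf

theorem eLpNorm_prod_le {ι : Type*} (s : Finset ι) {f : ι → Ω → ℝ}
    (p : ℝ≥0∞) (hf : ∀ i ∈ s, AEStronglyMeasurable (f i) P) :
    eLpNorm (fun ω => ∏ i ∈ s, f i ω) (∑ _i ∈ s, p⁻¹)⁻¹ P ≤ ∏ i ∈ s, eLpNorm (f i) p P := by
  induction s using Finset.cons_induction with
  | empty =>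
    simp only [Finset.prod_empty, Finset.sum_empty, ENNReal.inv_zero]
    rw [eLpNorm_const _ ENNReal.top_ne_zero (IsProbabilityMeasure.ne_zero P)]
    simp
  | cons i s hi ih =>
    simp only [Finset.prod_cons, Finset.sum_cons]
    have hf' : ∀ j ∈ s, AEStronglyMeasurable (f j) P :=
      fun j hj => hf j (Finset.mem_cons_of_mem hj)
    refine (eLpNorm_mul_le_of_inv_add (hf i (Finset.mem_cons_self _ _))
      (aestronglyMeasurable_prod s hf') p _).trans ?_
    gcongr
    exact ih hf'

-- Induction through xX - uU = (x-u)X + x(X-U) - (x-u)(X-U): every term has a factor tending to 0,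
-- and no uniform bound on the approximations is needed. The condition `hp` keeps the exponent at
-- least 1, as the triangle inequality requires.
omit [IsProbabilityMeasure P] in
theorem tendsto_eLpNorm_prod_sub {α ι : Type*} {l : Filter α} (s : Finset ι) {p : ℝ≥0∞}
    (hp : ∑ _i ∈ s, p⁻¹ ≤ 1) {U : α → ι → Ω → ℝ} {X : ι → Ω → ℝ}
    (hX : ∀ i ∈ s, MemLp (X i) p P) (hU : ∀ a, ∀ i ∈ s, MemLp (U a i) p P)
    (h : ∀ i ∈ s, Tendsto (fun a => eLpNorm (fun ω => X i ω - U a i ω) p P) l (𝓝 0)) :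
    Tendsto (fun a => eLpNorm (fun ω => ∏ i ∈ s, X i ω - ∏ i ∈ s, U a i ω)
      (∑ _i ∈ s, p⁻¹)⁻¹ P) l (𝓝 0) := by
  induction s using Finset.cons_induction with
  | empty =>
    simp only [Finset.prod_empty, sub_self]
    exact (tendsto_congr fun _ => eLpNorm_zero').2 tendsto_const_nhds
  | cons i s hi ih =>
    simp only [Finset.prod_cons, Finset.sum_cons] at hp ⊢
    have hs : ∀ {Q : ι → Prop}, (∀ j ∈ Finset.cons i s hi, Q j) → ∀ j ∈ s, Q j :=
      fun hQ j hj => hQ j (Finset.mem_cons_of_mem hj)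
    have hi' : i ∈ Finset.cons i s hi := Finset.mem_cons_self i s
    have hD := ih (le_add_self.trans hp) (hs hX) (fun a => hs (hU a)) (hs h)
    have he := h i hi'
    set c := ∑ _j ∈ s, p⁻¹ with hc
    have hXs : MemLp (fun ω => ∏ j ∈ s, X j ω) c⁻¹ P := MemLp.prod' (hs hX)
    have hUs : ∀ a, MemLp (fun ω => ∏ j ∈ s, U a j ω) c⁻¹ P := fun a => MemLp.prod' (hs (hU a))
    have hr : 1 ≤ (p⁻¹ + c)⁻¹ := ENNReal.one_le_inv.2 hp
    have hbound : ∀ a, eLpNorm (fun ω => X i ω * ∏ j ∈ s, X j ω - U a i ω * ∏ j ∈ s, U a j ω)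
        (p⁻¹ + c)⁻¹ P ≤
        eLpNorm (fun ω => X i ω - U a i ω) p P * eLpNorm (fun ω => ∏ j ∈ s, X j ω) c⁻¹ P +
        eLpNorm (X i) p P *
          eLpNorm (fun ω => ∏ j ∈ s, X j ω - ∏ j ∈ s, U a j ω) c⁻¹ P +
        eLpNorm (fun ω => X i ω - U a i ω) p P *
          eLpNorm (fun ω => ∏ j ∈ s, X j ω - ∏ j ∈ s, U a j ω) c⁻¹ P := by
      intro a
      have m1 : AEStronglyMeasurable (fun ω => X i ω - U a i ω) P :=
        ((hX i hi').sub (hU a i hi')).1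
      have m2 := hXs.1
      have m3 : AEStronglyMeasurable (fun ω => ∏ j ∈ s, X j ω - ∏ j ∈ s, U a j ω) P :=
        (hXs.sub (hUs a)).1
      have heq : (fun ω => X i ω * ∏ j ∈ s, X j ω - U a i ω * ∏ j ∈ s, U a j ω) =
          ((fun ω => (X i ω - U a i ω) * ∏ j ∈ s, X j ω) +
            fun ω => X i ω * (∏ j ∈ s, X j ω - ∏ j ∈ s, U a j ω)) -
            fun ω => (X i ω - U a i ω) * (∏ j ∈ s, X j ω - ∏ j ∈ s, U a j ω) := by
        ext ω
        simp only [Pi.add_apply, Pi.sub_apply]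
        ring
      rw [heq]
      refine (eLpNorm_sub_le ((m1.mul m2).add ((hX i hi').1.mul m3)) (m1.mul m3) hr).trans ?_
      refine add_le_add ((eLpNorm_add_le (m1.mul m2) ((hX i hi').1.mul m3) hr).trans ?_)
        (eLpNorm_mul_le_of_inv_add m1 m3 p c)
      exact add_le_add (eLpNorm_mul_le_of_inv_add m1 m2 p c)
        (eLpNorm_mul_le_of_inv_add (hX i hi').1 m3 p c)
    have hlim := ((ENNReal.Tendsto.mul_const he (Or.inr hXs.2.ne)).add
      (ENNReal.Tendsto.const_mul hD (Or.inr (hX i hi').2.ne))).add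
        (ENNReal.Tendsto.mul he (Or.inr ENNReal.zero_ne_top) hD (Or.inr ENNReal.zero_ne_top))
    simp only [zero_mul, mul_zero, add_zero] at hlim
    exact tendsto_of_tendsto_of_tendsto_of_le_of_le tendsto_const_nhds hlim (fun _ => zero_le)
      hbound

theorem integrable_prod_of_memLp {ι : Type*} (s : Finset ι) {p : ℝ≥0∞} (hp : ∑ _i ∈ s, p⁻¹ ≤ 1)
    {X : ι → Ω → ℝ} (hX : ∀ i ∈ s, MemLp (X i) p P) : Integrable (fun ω => ∏ i ∈ s, X i ω) P :=
  (MemLp.prod' hX).integrable (ENNReal.one_le_inv.2 hp)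

theorem tendsto_integral_prod {α ι : Type*} {l : Filter α} (s : Finset ι) {p : ℝ≥0∞}
    (hp : ∑ _i ∈ s, p⁻¹ ≤ 1) {U : α → ι → Ω → ℝ} {X : ι → Ω → ℝ}
    (hX : ∀ i ∈ s, MemLp (X i) p P) (hU : ∀ a, ∀ i ∈ s, MemLp (U a i) p P)
    (h : ∀ i ∈ s, Tendsto (fun a => eLpNorm (fun ω => X i ω - U a i ω) p P) l (𝓝 0)) :
    Tendsto (fun a => ∫ ω, ∏ i ∈ s, U a i ω ∂P) l (𝓝 (∫ ω, ∏ i ∈ s, X i ω ∂P)) := by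
  have hiX := integrable_prod_of_memLp s hp hX
  have hiU := fun a => integrable_prod_of_memLp s hp (hU a)
  refine tendsto_integral_of_L1' _ hiX.1 (Eventually.of_forall hiU) ?_
  refine tendsto_of_tendsto_of_tendsto_of_le_of_le tendsto_const_nhds
    (tendsto_eLpNorm_prod_sub s hp hX hU h) (fun _ => zero_le) fun a => ?_
  rw [eLpNorm_sub_comm]
  exact eLpNorm_le_eLpNorm_of_exponent_le (ENNReal.one_le_inv.2 hp) (hiX.sub (hiU a)).1

theorem abs_integral_prod_le {ι : Type*} (s : Finset ι) {p : ℝ≥0∞} (hp : ∑ _i ∈ s, p⁻¹ ≤ 1)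
    {X : ι → Ω → ℝ} (hX : ∀ i ∈ s, MemLp (X i) p P) :
    |∫ ω, ∏ i ∈ s, X i ω ∂P| ≤ ∏ i ∈ s, (eLpNorm (X i) p P).toReal := by
  have hi := integrable_prod_of_memLp s hp hX
  rw [← Real.norm_eq_abs, ← ENNReal.toReal_prod]
  refine (norm_integral_le_integral_norm _).trans ?_
  rw [integral_norm_eq_lintegral_enorm hi.1, ← eLpNorm_one_eq_lintegral_enorm]
  refine ENNReal.toReal_mono (ENNReal.prod_ne_top fun i his => (hX i his).2.ne) ?_
  exact (eLpNorm_le_eLpNorm_of_exponent_le (ENNReal.one_le_inv.2 hp) hi.1).trans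
    (eLpNorm_prod_le s p fun i his => (hX i his).1)

end Hoelder

/-! ### Multiple series -/

section MultiSum

variable {k : ℕ}

theorem tendsto_piFinset_range :
    Tendsto (fun N : Fin k → ℕ => Fintype.piFinset fun i => Finset.range (N i)) atTop atTop := by
  refine tendsto_atTop_finset_of_monotone (fun N N' h => ?_) fun n => ?_
  · exact Fintype.piFinset_subset _ _ fun i => Finset.range_mono (h i)
  · exact ⟨fun i => n i + 1, by simp⟩

/-- The boxes eventually contain every finite set of indices, so the rectangular limit is the
unconditional sum. -/
theorem HasMultiSum.hasSum {T : (Fin k → ℕ) → ℝ} {s : ℝ} (h : HasMultiSum T s)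
    (hT : Summable T) : HasSum T s := by
  have h1 := hT.hasSum.comp tendsto_piFinset_range
  have h2 : ∑' n, T n = s := tendsto_nhds_unique h1 h
  exact h2 ▸ hT.hasSum

/-- Every finite set of multi-indices lies in a box, where the sum of products is a product of sums.
-/
theorem summable_prod_apply {b : Fin k → ℕ → ℝ} (hb0 : ∀ i n, 0 ≤ b i n)
    (hb : ∀ i, Summable (b i)) : Summable fun n : Fin k → ℕ => ∏ i, b i (n i) := by
  refine summable_of_sum_le (c := ∏ i, ∑' n, b i n) (fun n => Finset.prod_nonneg fun i _ => hb0 i _)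
    fun u => ?_
  have hsub : u ⊆ Fintype.piFinset fun i => u.image fun n => n i := by
    intro n hn
    simp only [Fintype.mem_piFinset, Finset.mem_image]
    exact fun i => ⟨n, hn, rfl⟩
  refine (Finset.sum_le_sum_of_subset_of_nonneg hsub fun n _ _ =>
    Finset.prod_nonneg fun i _ => hb0 i _).trans ?_
  rw [← Finset.prod_univ_sum]
  exact Finset.prod_le_prod (fun i _ => Finset.sum_nonneg fun n _ => hb0 i n)
    fun i _ => (hb i).sum_le_tsum _ fun n _ => hb0 i n

theorem tendsto_apply_atTop (i : Fin k) : Tendsto (fun N : Fin k → ℕ => N i) atTop atTop :=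
  tendsto_atTop.2 fun b => mem_of_superset (mem_atTop fun _ => b) fun _ hN => hN i

end MultiSum

/-! ### Bounds, limits and multilinearity of cumulants -/

section Multilinear

variable {k : ℕ}

/-- The blocks of each partition exhaust S disjointly, so every term is bounded by the same product
of weights. -/
theorem abs_setCumulant_le {ι : Type*} [DecidableEq ι] {M : Finset ι → ℝ} {w : ι → ℝ}
    (hM : ∀ B, |M B| ≤ ∏ i ∈ B, w i) (S : Finset ι) :
    |setCumulant M S| ≤ (∑ π : Finpartition S, |cumulantCoeff π.parts.card|) * ∏ i ∈ S, w i := by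
  rw [setCumulant, Finset.sum_mul]
  refine (Finset.abs_sum_le_sum_abs _ _).trans (Finset.sum_le_sum fun π _ => ?_)
  rw [abs_mul, Finset.abs_prod]
  have h : ∏ i ∈ S, w i = ∏ B ∈ π.parts, ∏ i ∈ B, w i := by
    conv_lhs => rw [← π.biUnion_parts]
    exact Finset.prod_biUnion π.disjoint
  rw [h]
  exact mul_le_mul_of_nonneg_left (Finset.prod_le_prod (fun B _ => abs_nonneg _) fun B _ => hM B)
    (abs_nonneg _)

theorem tendsto_setCumulant {α ι : Type*} [DecidableEq ι] {l : Filter α} {M : α → Finset ι → ℝ}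
    {M' : Finset ι → ℝ} (h : ∀ B, Tendsto (fun a => M a B) l (𝓝 (M' B))) (S : Finset ι) :
    Tendsto (fun a => setCumulant (M a) S) l (𝓝 (setCumulant M' S)) :=
  tendsto_finsetSum _ fun _ _ => (tendsto_finsetProd _ fun B _ => h B).const_mul _

variable {R : Type*} [CommRing R] [Algebra ℝ R]

/-- In each partition the index i lies in exactly one block, so each summand is visibly linear in
the entry `v`. -/
theorem setCumulant_update {ι : Type*} [DecidableEq ι] [Fintype ι] (E : R →ₗ[ℝ] ℝ) (m : ι → R)
    (i : ι) (v : R) :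
    setCumulant (fun B => E (∏ l ∈ B, Function.update m i v l)) Finset.univ =
      ∑ π : Finpartition (Finset.univ : Finset ι), cumulantCoeff π.parts.card *
        (E (v * ∏ l ∈ (π.part i).erase i, m l) *
          ∏ B ∈ π.parts.erase (π.part i), E (∏ l ∈ B, m l)) := by
  rw [setCumulant]
  refine Finset.sum_congr rfl fun π _ => ?_
  have hp : π.part i ∈ π.parts := π.part_mem.2 (Finset.mem_univ i)
  have hi : i ∈ π.part i := π.mem_part_self.2 (Finset.mem_univ i)
  have h1 : ∏ l ∈ π.part i, Function.update m i v l = v * ∏ l ∈ (π.part i).erase i, m l := by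
    rw [← Finset.mul_prod_erase _ _ hi, Function.update_self]
    congr 1
    refine Finset.prod_congr rfl fun l hl => ?_
    rw [Function.update_of_ne (Finset.ne_of_mem_erase hl)]
  have h2 : ∀ B ∈ π.parts.erase (π.part i), ∏ l ∈ B, Function.update m i v l = ∏ l ∈ B, m l := by
    intro B hB
    obtain ⟨hne, hB'⟩ := Finset.mem_erase.1 hB
    refine Finset.prod_congr rfl fun l hl => ?_
    rw [Function.update_of_ne]
    intro h
    exact hne ((π.part_eq_iff_mem hB').2 (h ▸ hl)).symm
  rw [← Finset.mul_prod_erase π.parts _ hp, h1]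
  congr 2
  exact Finset.prod_congr rfl fun B hB => by rw [h2 B hB]

/-- The joint cumulant of `m 1, …, m k` under the functional `E`. -/
def cumulantMultilinear (E : R →ₗ[ℝ] ℝ) : MultilinearMap ℝ (fun _ : Fin k => R) ℝ where
  toFun m := setCumulant (fun B => E (∏ l ∈ B, m l)) Finset.univ
  map_update_add' {inst} m i x y := by
    obtain rfl : inst = instDecidableEqFin k := Subsingleton.elim _ _
    simp only [setCumulant_update, add_mul, map_add, mul_add, Finset.sum_add_distrib]
  map_update_smul' {inst} m i c x := by
    obtain rfl : inst = instDecidableEqFin k := Subsingleton.elim _ _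
    simp only [setCumulant_update, smul_mul_assoc, map_smul, smul_eq_mul, Finset.mul_sum]
    exact Finset.sum_congr rfl fun π _ => by ring

theorem multilinear_sum_smul (T : MultilinearMap ℝ (fun _ : Fin k => R) ℝ) (a : ℕ → ℝ)
    (g : Fin k → ℕ → R) (N : Fin k → ℕ) :
    T (fun i => ∑ n ∈ Finset.range (N i), a n • g i n) =
      ∑ n ∈ Fintype.piFinset fun i => Finset.range (N i),
        (∏ i, a (n i)) * T fun i => g i (n i) := by
  rw [T.map_sum_finset (fun i n => a n • g i n) fun i => Finset.range (N i)]
  refine Finset.sum_congr rfl fun n _ => ?_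
  rw [T.map_smul_univ (fun i => a (n i)) fun i => g i (n i), smul_eq_mul]

end Multilinear

/-! ### The field inside L² and its Wick powers -/

section Field

variable {L Ω : Type*} [MeasurableSpace Ω] {P : Measure Ω} [IsProbabilityMeasure P]
  {G : Matrix L L ℝ} {φ : L → Ω → ℝ}

omit [IsProbabilityMeasure P] in
theorem IsGaussianField.memLp_two (hφ : IsGaussianField P G φ) (hG : G.PosDef) (x : L) :
    MemLp (φ x) 2 P := by
  obtain ⟨T, hT, h, -⟩ := hφ.exists_law hG {x}
  exact (h.eval ⟨x, hT (Finset.mem_singleton_self x)⟩).memLp_two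

theorem IsGaussianField.integral_mul (hφ : IsGaussianField P G φ) (hG : G.PosDef) (x y : L) :
    ∫ ω, φ x ω * φ y ω ∂P = G x y := by
  classical
  obtain ⟨T, hT, -, h0, hc⟩ := hφ.exists_law hG {x, y}
  have hx : x ∈ T := hT (by simp)
  have hy : y ∈ T := hT (by simp)
  rw [← hc x hx y hy, covariance_eq_sub (hφ.memLp_two hG x) (hφ.memLp_two hG y), h0 x hx, h0 y hy]
  simp

/-- The value `φ x` of the field as an element of `L²`. -/
def IsGaussianField.toLp (hφ : IsGaussianField P G φ) (hG : G.PosDef) (x : L) : Lp ℝ 2 P :=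
  (hφ.memLp_two hG x).toLp _

omit [IsProbabilityMeasure P] in
theorem IsGaussianField.coeFn_toLp (hφ : IsGaussianField P G φ) (hG : G.PosDef) (x : L) :
    hφ.toLp hG x =ᵐ[P] φ x := (hφ.memLp_two hG x).coeFn_toLp

omit [IsProbabilityMeasure P] in
theorem IsGaussianField.toLp_mem (hφ : IsGaussianField P G φ) (hG : G.PosDef) (x : L) :
    hφ.toLp hG x ∈ gaussianSpace P φ :=
  Submodule.le_topologicalClosure _ (Submodule.subset_span ⟨x, hφ.coeFn_toLp hG x⟩)

theorem IsGaussianField.inner_toLp (hφ : IsGaussianField P G φ) (hG : G.PosDef) (x y : L) :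
    inner ℝ (hφ.toLp hG x) (hφ.toLp hG y) = G x y := by
  rw [real_inner_eq_integral, ← hφ.integral_mul hG]
  refine integral_congr_ae ?_
  filter_upwards [hφ.coeFn_toLp hG x, hφ.coeFn_toLp hG y] with ω h1 h2
  rw [h1, h2]

/-- The Wick power is the Hermite polynomial of the field. -/
theorem IsGaussianField.wickPower_ae_eq (hφ : IsGaussianField P G φ) (hG : G.PosDef) (x : L)
    (n : ℕ) : wickPower P φ x n =ᵐ[P] fun ω => (hermiteVar (G x x) n).eval (hφ.toLp hG x ω) := by
  have hH := isGaussianSubmodule_gaussianSpace hG hφ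
  have hpow : (fun ω => φ x ω ^ n) =ᵐ[P] fun ω => hφ.toLp hG x ω ^ n := by
    filter_upwards [hφ.coeFn_toLp hG x] with ω h
    rw [h]
  have hm : MemLp (fun ω => φ x ω ^ n) 2 P := by
    refine (memLp_congr_ae hpow).2 ?_
    simpa using (hH.hasAllMoments (hφ.toLp_mem hG x)).polynomial_eval (Polynomial.X ^ n) 2 (by simp)
  rw [wickPower, dif_pos hm, ← hφ.inner_toLp hG]
  exact hH.starProjection_pow (hφ.toLp_mem hG x) n (hm.coeFn_toLp.trans hpow)

end Field

/-! ### Moments and cumulants of truncated Wick series -/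

section Functional

open MvPolynomial

variable {k : ℕ} {C : Fin k → Fin k → ℝ} {E : MvPolynomial (Fin k) ℝ →ₗ[ℝ] ℝ}

/-- Setting the degrees outside B to 0 turns the other Hermite factors into 1. -/
theorem IsSteinFunctional.prod_mem_hermiteX (hC : ∀ i j, C i j = C j i)
    (hE : IsSteinFunctional C E) (h1 : E 1 = 1) (n : Fin k → ℕ) (B : Finset (Fin k)) :
    E (∏ l ∈ B, hermiteX (C l l) l (n l)) =
      (∏ l ∈ B, ((n l).factorial : ℝ)) * graphSum C (degreesOn n B) := by
  have h := hE.prod_hermiteX hC h1 (degreesOn n B)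
  rw [← Finset.prod_subset (Finset.subset_univ B), ← Finset.prod_subset (Finset.subset_univ B)] at h
  · rw [Finset.prod_congr rfl fun l hl => ?_, h, Finset.prod_congr rfl fun l hl => ?_]
    all_goals simp [degreesOn, hl]
  all_goals
    intro l _ hl
    simp [degreesOn, hl, hermiteX_zero]

theorem IsSteinFunctional.setCumulant_hermiteX (hC : ∀ i j, C i j = C j i)
    (hE : IsSteinFunctional C E) (h1 : E 1 = 1) (hk : 0 < k) (n : Fin k → ℕ) :
    setCumulant (fun B => E (∏ l ∈ B, hermiteX (C l l) l (n l))) Finset.univ =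
      ∑ q ∈ connectedMultigraphs n, (feynmanCount n q : ℝ) * edgeProd C q := by
  have hne : (Finset.univ : Finset (Fin k)).Nonempty := ⟨⟨0, hk⟩, Finset.mem_univ _⟩
  classical
  simp only [hE.prod_mem_hermiteX hC h1]
  rw [setCumulant_graphSum C n hne, ← connectedMultigraphs_eq, Finset.mul_sum]
  exact Finset.sum_congr rfl fun q hq =>
    (feynmanCount_mul_edgeProd C (Finset.mem_filter.1 hq).1).symm

theorem IsSteinFunctional.prod_hermiteX_eq_sum (hC : ∀ i j, C i j = C j i)
    (hE : IsSteinFunctional C E) (h1 : E 1 = 1) (n : Fin k → ℕ) :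
    E (∏ l, hermiteX (C l l) l (n l)) =
      ∑ q ∈ multigraphs n, (feynmanCount n q : ℝ) * edgeProd C q := by
  rw [hE.prod_hermiteX hC h1, graphSum, Finset.mul_sum]
  exact Finset.sum_congr rfl fun q hq => (feynmanCount_mul_edgeProd C hq).symm

/-- The partial sum `∑_{m < N} a m :X_i^m:` as a polynomial. -/
def wickPartialSum (C : Fin k → Fin k → ℝ) (a : ℕ → ℝ) (N : Fin k → ℕ) (i : Fin k) :
    MvPolynomial (Fin k) ℝ := ∑ m ∈ Finset.range (N i), a m • hermiteX (C i i) i m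

theorem IsSteinFunctional.prod_wickPartialSum (hC : ∀ i j, C i j = C j i)
    (hE : IsSteinFunctional C E) (h1 : E 1 = 1) (a : ℕ → ℝ) (N : Fin k → ℕ) :
    E (∏ i, wickPartialSum C a N i) =
      ∑ n ∈ Fintype.piFinset fun i => Finset.range (N i), (∏ i, a (n i)) *
        ∑ q ∈ multigraphs n, (feynmanCount n q : ℝ) * edgeProd C q := by
  have h := multilinear_sum_smul
    (E.compMultilinearMap (MultilinearMap.mkPiAlgebra ℝ (Fin k) (MvPolynomial (Fin k) ℝ))) a
    (fun i m => hermiteX (C i i) i m) N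
  simp only [LinearMap.compMultilinearMap_apply, MultilinearMap.mkPiAlgebra_apply,
    hE.prod_hermiteX_eq_sum hC h1] at h
  exact h

/-- Multilinearity of the cumulant makes this an exact identity for each N; the limit enters only
afterwards. -/
theorem IsSteinFunctional.setCumulant_wickPartialSum (hC : ∀ i j, C i j = C j i)
    (hE : IsSteinFunctional C E) (h1 : E 1 = 1) (hk : 0 < k) (a : ℕ → ℝ) (N : Fin k → ℕ) :
    setCumulant (fun B => E (∏ i ∈ B, wickPartialSum C a N i)) Finset.univ =
      ∑ n ∈ Fintype.piFinset fun i => Finset.range (N i), (∏ i, a (n i)) *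
        ∑ q ∈ connectedMultigraphs n, (feynmanCount n q : ℝ) * edgeProd C q := by
  have h := multilinear_sum_smul (cumulantMultilinear E) a (fun i m => hermiteX (C i i) i m) N
  refine h.trans (Finset.sum_congr rfl fun n _ => ?_)
  rw [← hE.setCumulant_hermiteX hC h1 hk n]
  rfl

theorem IsSteinFunctional.summable_multigraphs (hC : ∀ i j, C i j = C j i)
    (hE : IsSteinFunctional C E) (h1 : E 1 = 1) {w : Fin k → ℕ → ℝ}
    (hw : ∀ (n : Fin k → ℕ) (B : Finset (Fin k)),
      |E (∏ l ∈ B, hermiteX (C l l) l (n l))| ≤ ∏ l ∈ B, w l (n l)) {a : ℕ → ℝ}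
    (hw0 : ∀ i m, 0 ≤ w i m)
    (hs : ∀ i, Summable fun m => |a m| * w i m) :
    Summable fun n : Fin k → ℕ => (∏ i, a (n i)) *
        ∑ q ∈ multigraphs n, (feynmanCount n q : ℝ) * edgeProd C q := by
  refine Summable.of_norm_bounded
    (summable_prod_apply (fun i m => mul_nonneg (abs_nonneg _) (hw0 i m)) hs) fun n => ?_
  rw [Real.norm_eq_abs, abs_mul, Finset.abs_prod, Finset.prod_mul_distrib,
    ← hE.prod_hermiteX_eq_sum hC h1]
  exact mul_le_mul_of_nonneg_left (hw n _) (Finset.prod_nonneg fun i _ => abs_nonneg _)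

theorem IsSteinFunctional.summable_connectedMultigraphs (hC : ∀ i j, C i j = C j i)
    (hE : IsSteinFunctional C E) (h1 : E 1 = 1) (hk : 0 < k) {w : Fin k → ℕ → ℝ}
    (hw : ∀ (n : Fin k → ℕ) (B : Finset (Fin k)),
      |E (∏ l ∈ B, hermiteX (C l l) l (n l))| ≤ ∏ l ∈ B, w l (n l)) {a : ℕ → ℝ}
    (hw0 : ∀ i m, 0 ≤ w i m)
    (hs : ∀ i, Summable fun m => |a m| * w i m) :
    Summable fun n : Fin k → ℕ => (∏ i, a (n i)) *
        ∑ q ∈ connectedMultigraphs n, (feynmanCount n q : ℝ) * edgeProd C q := by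
  refine Summable.of_norm_bounded (((summable_prod_apply
    (fun i m => mul_nonneg (abs_nonneg _) (hw0 i m)) hs)).mul_left
    (∑ π : Finpartition (Finset.univ : Finset (Fin k)), |cumulantCoeff π.parts.card|)) fun n => ?_
  rw [Real.norm_eq_abs, abs_mul, Finset.abs_prod, Finset.prod_mul_distrib, mul_left_comm,
    ← hE.setCumulant_hermiteX hC h1 hk]
  exact mul_le_mul_of_nonneg_left (abs_setCumulant_le (hw n) _)
    (Finset.prod_nonneg fun i _ => abs_nonneg _)

end Functional

/-- The exponent max(2, k) is large enough for Hölder with any of the at most k factors. -/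
theorem sum_inv_max_two_le_one {k : ℕ} (B : Finset (Fin k)) :
    ∑ _i ∈ B, (max 2 (k : ℝ≥0∞))⁻¹ ≤ 1 := by
  rw [Finset.sum_const, nsmul_eq_mul, ← div_eq_mul_inv]
  refine ENNReal.div_le_of_le_mul ?_
  rw [one_mul]
  refine le_trans ?_ (le_max_right _ _)
  exact_mod_cast B.card_le_univ.trans_eq (Fintype.card_fin k)

end

end WickAnalytic

/-! ### The main theorem -/

theorem theorem2p3 {d : ℕ} (hd : 2 ≤ d) (Λ : Set (Fin d → ℤ))
    (G : Matrix Λ Λ ℝ) (hG : G.PosDef)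
    {Ω : Type*} [MeasurableSpace Ω] (P : Measure Ω) [IsProbabilityMeasure P]
    (φ : Λ → Ω → ℝ) (hφ : IsGaussianField P G φ)
    (f : ℝ → ℝ) (a : ℕ → ℝ) (hf : ∀ t, HasSum (fun n => a n * t ^ n) (f t))
    {k : ℕ} (hk : 0 < k) (x : Fin k → Λ) (hx : Function.Injective x)
    -- `X i` is `:f(φ(x i)):`
    (X : Fin k → Ω → ℝ) (hX : ∀ i, IsWickSeries P (max 2 (k : ℝ≥0∞)) φ (x i) a (X i)) :
    -- the explicit value of the multiplicity
    (∀ (n : Fin k → ℕ), ∀ q ∈ multigraphs n,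
      feynmanCount n q * ∏ i, ∏ j ∈ Finset.Ioi i, (q i j).factorial = ∏ i, (n i).factorial) ∧
    -- the moments exist
    (∀ B : Finset (Fin k), Integrable (fun ω => ∏ i ∈ B, X i ω) P) ∧
    -- the expectation of the product
    HasMultiSum
      (fun n => (∏ i, a (n i)) * ∑ q ∈ multigraphs n,
        (feynmanCount n q : ℝ) * edgeProd (fun i j => G (x i) (x j)) q)
      (∫ ω, ∏ i, X i ω ∂P) ∧
    -- the joint cumulant
    HasMultiSum
      (fun n => (∏ i, a (n i)) * ∑ q ∈ connectedMultigraphs n,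
        (feynmanCount n q : ℝ) * edgeProd (fun i j => G (x i) (x j)) q)
      (jointCumulant P X) ∧
    -- if the Wick series converge absolutely, so do both multiple series
    ((∀ i, ∑' n, ENNReal.ofReal |a n| *
        eLpNorm (wickPower P φ (x i) n) (max 2 (k : ℝ≥0∞)) P ≠ ∞) →
      HasSum
        (fun n : Fin k → ℕ => (∏ i, a (n i)) * ∑ q ∈ multigraphs n,
          (feynmanCount n q : ℝ) * edgeProd (fun i j => G (x i) (x j)) q)
        (∫ ω, ∏ i, X i ω ∂P) ∧
      HasSum
        (fun n : Fin k → ℕ => (∏ i, a (n i)) * ∑ q ∈ connectedMultigraphs n,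
          (feynmanCount n q : ℝ) * edgeProd (fun i j => G (x i) (x j)) q)
        (jointCumulant P X)) := by
  set p : ℝ≥0∞ := max 2 (k : ℝ≥0∞)
  have hp : p ≠ ∞ := (max_lt (by simp) (ENNReal.natCast_lt_top k)).ne
  have hpB : ∀ B : Finset (Fin k), ∑ _i ∈ B, p⁻¹ ≤ 1 := sum_inv_max_two_le_one
  have hH := isGaussianSubmodule_gaussianSpace hG hφ
  set η : Fin k → Lp ℝ 2 P := fun i => hφ.toLp hG (x i)
  have hη : ∀ i, η i ∈ gaussianSpace P φ := fun i => hφ.toLp_mem hG (x i)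
  have hmom : ∀ i, HasAllMoments P (η i) := fun i => hH.hasAllMoments (hη i)
  set C : Fin k → Fin k → ℝ := fun i j => G (x i) (x j)
  have hC : ∀ i j, C i j = C j i := fun i j => by
    simpa using hG.isHermitian.apply (x j) (x i)
  set E := polyExpectation hmom
  have hE : IsSteinFunctional C E := by
    have h := hH.isSteinFunctional hη
    have hCη : (fun i j => inner ℝ (η i) (η j)) = C := by
      ext i j
      exact hφ.inner_toLp hG (x i) (x j)
    rwa [hCη] at h
  have h1 : E 1 = 1 := by simp [E, polyExpectation_apply]
  have hEprod : ∀ (g : Fin k → MvPolynomial (Fin k) ℝ) (B : Finset (Fin k)), E (∏ i ∈ B, g i) =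
      ∫ ω, ∏ i ∈ B, MvPolynomial.eval (fun j => η j ω) (g i) ∂P := fun g B => by
    simp only [E, polyExpectation_apply, map_prod]
  have hwick : ∀ i m, wickPower P φ (x i) m =ᵐ[P] fun ω =>
      MvPolynomial.eval (fun j => η j ω) (hermiteX (C i i) i m) := fun i m => by
    simp only [eval_hermiteX]
    exact hφ.wickPower_ae_eq hG (x i) m
  set U : (Fin k → ℕ) → Fin k → Ω → ℝ := fun N i ω =>
    MvPolynomial.eval (fun j => η j ω) (wickPartialSum C a N i)
  have hXm : ∀ i, MemLp (X i) p P := fun i => (hX i).1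
  have hUm : ∀ N i, MemLp (U N i) p P := fun N i => HasAllMoments.mvPolynomial_eval hmom _ p hp
  -- The i-th truncation depends on N only through N_i, so convergence holds as the N_i grow
  -- independently.
  have hU : ∀ i, Tendsto (fun N => eLpNorm (fun ω => X i ω - U N i ω) p P) atTop (𝓝 0) := by
    intro i
    refine ((hX i).2.comp (tendsto_apply_atTop i)).congr fun N => eLpNorm_congr_ae ?_
    have := (ae_all_iff (μ := P)).2 fun m => hwick i m
    filter_upwards [this] with ω hω
    simp only [U, wickPartialSum, map_sum, MvPolynomial.smul_eval, hω]
  -- All subsets B are needed, since the cumulant is a polynomial in the moments of the blocks.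
  have hlim : ∀ B : Finset (Fin k), Tendsto (fun N => E (∏ i ∈ B, wickPartialSum C a N i)) atTop
      (𝓝 (∫ ω, ∏ i ∈ B, X i ω ∂P)) := by
    intro B
    simp only [hEprod]
    exact tendsto_integral_prod B (hpB B) (fun i _ => hXm i) (fun N i _ => hUm N i) fun i _ => hU i
  have hmoment : HasMultiSum (fun n => (∏ i, a (n i)) * ∑ q ∈ multigraphs n,
      (feynmanCount n q : ℝ) * edgeProd C q) (∫ ω, ∏ i, X i ω ∂P) :=
    (hlim Finset.univ).congr fun N => hE.prod_wickPartialSum hC h1 a N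
  have hcumulant : HasMultiSum (fun n => (∏ i, a (n i)) * ∑ q ∈ connectedMultigraphs n,
      (feynmanCount n q : ℝ) * edgeProd C q) (jointCumulant P X) :=
    (tendsto_setCumulant hlim Finset.univ).congr fun N =>
      hE.setCumulant_wickPartialSum hC h1 hk a N
  refine ⟨fun n q hq => feynmanCount_mul_prod_factorial hq,
    fun B => integrable_prod_of_memLp B (hpB B) fun i _ => hXm i, hmoment, hcumulant,
    fun habs => ?_⟩
  -- Hölder bounds the moments of all blocks by products of L^p norms of Wick powers, which
  -- dominates the terms of both series.
  have hw : ∀ (n : Fin k → ℕ) (B : Finset (Fin k)),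
      |E (∏ l ∈ B, hermiteX (C l l) l (n l))| ≤
        ∏ l ∈ B, (eLpNorm (wickPower P φ (x l) (n l)) p P).toReal := by
    intro n B
    simp only [hEprod, eLpNorm_congr_ae (hwick _ _)]
    exact abs_integral_prod_le B (hpB B) fun i _ =>
      HasAllMoments.mvPolynomial_eval hmom _ p hp
  have hs : ∀ i, Summable fun m => |a m| * (eLpNorm (wickPower P φ (x i) m) p P).toReal := by
    intro i
    simpa [ENNReal.toReal_mul] using ENNReal.summable_toReal (habs i)
  exact ⟨hmoment.hasSum (hE.summable_multigraphs hC h1 hw (fun _ _ => ENNReal.toReal_nonneg) hs),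
    hcumulant.hasSum
      (hE.summable_connectedMultigraphs hC h1 hk hw (fun _ _ => ENNReal.toReal_nonneg) hs)⟩
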